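/- Blow-up for the Geng–Xue system. Let $s>\frac52$, let $u_0\in W^{1,1}(\mathbb R)\cap H^s(\mathbb R)$ and $v_0\in H^s(\mathbb R)$ be real valued, and put $p(x)=\frac12e^{-|x|}$ and $n_0=v_0-v_{0,xx}$. Consider the Cauchy problem $$\begin{cases}u_t+uvu_x+p*\bigl(3uvu_x+2uv_xu_{xx}+2u_x^2v_x+uv_{xx}u_x\bigr)=0,\\ v_t+vuv_x+p*\bigl(3vuv_x+2vu_xv_{xx}+2v_x^2u_x+vu_{xx}v_x\bigr)=0,\\ u(0,x)=u_0(x),\quad v(0,x)=v_0(x),\end{cases}\qquad x\in\mathbb R.$$ A strong solution on $[0,T)$ is a pair $(u,v)\in C([0,T);H^s\times H^s)$ that satisfies it, and the maximal existence time $T^*\in[0,\infty]$ is the supremum of all $T>0$ for which there is a strong solution on $[0,T)$. Let $x_0\in\mathbb R$ be a point with $v_0(x_0)>0$, and set $$M=\|u_0\|_{W^{1,1}}+\|n_0\|_{L^\infty},\qquad b_1=\frac{4}{v_0(x_0)}M^4+14M^3,\qquad T_2=\frac{v_0(x_0)}{80M^3},$$ where $\|u_0\|_{W^{1,1}}=\|u_0\|_{L^1}+\|u_{0,x}\|_{L^1}$.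 Assume that $$u_{0,x}(x_0)\le\frac{1+e^{\sqrt{b_1v_0^3(x_0)}/(80M^3)}}{1-e^{\sqrt{b_1v_0^3(x_0)}/(80M^3)}}\sqrt{\frac{b_1}{v_0(x_0)}}.$$ Then the strong solution $(u,v)$ blows up in finite time, that is, $T^*<\infty$. More precisely, $$T^*\le T_0:=\frac1{\sqrt{b_1v_0(x_0)}}\ln\left(\frac{\sqrt{v_0(x_0)}\,u_{0,x}(x_0)-\sqrt{b_1}}{\sqrt{v_0(x_0)}\,u_{0,x}(x_0)+\sqrt{b_1}}\right),\qquad 0<T_0\le T_2,\qquad T^*<T_2.$$ Moreover, for every strong solution $(u,v)$ on an interval $[0,T)$, $T>0$, there is a characteristic $q$ with $q'(t)=(uv)(t,q(t))$ on $[0,T)$ and $q(0)=x_0$, and along it $$u_x(t,q(t))\le\frac{1+e^{\sqrt{b_1v_0(x_0)}\,(T_0-t)}}{1-e^{\sqrt{b_1v_0(x_0)}\,(T_0-t)}}\sqrt{\frac{b_1}{v_0(x_0)}},\qquad 0\le t<T,$$ where the right-hand side tends to $-\infty$ as $t\uparrow T_0$. -/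

import Mathlib

open MeasureTheory Set
open scoped ENNReal Convolution SchwartzMap

namespace GengXue

noncomputable section

/-- `HasBessel s f g` says that the real function `f` lies in `L²(ℝ)` and that the Bessel potential
`⟨D⟩ˢ f` of order `s` (Fourier multiplier with symbol `(1 + |ξ|²)^(s/2)`) is the `L²` function `g`.
So `f` belongs to `Hˢ(ℝ)` exactly if such a `g` exists, and the norm of `f` in `Hˢ(ℝ)` is then the
`L²` norm of `g`. -/
def HasBessel (s : ℝ) (f : ℝ → ℝ) (g : Lp ℂ 2 (volume : Measure ℝ)) : Prop :=
  ∃ hf : MemLp (fun x => (f x : ℂ)) 2 (volume : Measure ℝ),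
    TemperedDistribution.besselPotential ℝ ℂ s (hf.toLp _ : 𝓢'(ℝ, ℂ)) = (g : 𝓢'(ℝ, ℂ))

/-- Membership in `Hˢ(ℝ)`, for real functions. For `s > 1/2` every class in `Hˢ(ℝ)` has exactly one
continuous representative; this is the one that is meant (for `s > 5/2` it is of class `C²`, so that
the classical derivatives `deriv f` and `deriv (deriv f)` are the weak ones). -/
def MemHs (s : ℝ) (f : ℝ → ℝ) : Prop :=
  Continuous f ∧ ∃ g, HasBessel s f g

/-- `w ∈ C([0,T); Hˢ(ℝ))`: every `w t` is (the continuous representative of) an element of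
`Hˢ(ℝ)`, and `t ↦ ⟨D⟩ˢ w(t)` is continuous from `[0,T)` to `L²(ℝ)`. -/
def ContinuousInHs (s T : ℝ) (w : ℝ → ℝ → ℝ) : Prop :=
  (∀ t ∈ Ico 0 T, Continuous (w t)) ∧
  ∃ W : ℝ → Lp ℂ 2 (volume : Measure ℝ),
    ContinuousOn W (Ico 0 T) ∧ ∀ t ∈ Ico 0 T, HasBessel s (w t) (W t)

/-- The Green function `p(x) = e^{-|x|} / 2` of `1 - ∂ₓ²`. -/
def green (x : ℝ) : ℝ := Real.exp (-|x|) / 2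

/-- The right-hand side `-(f g f' + p * (3 f g f' + 2 f g' f'' + 2 (f')² g' + f g'' f'))`. The first
equation of the system is `u_t = rhs u v`, and the second one is `v_t = rhs v u`. -/
def rhs (f g : ℝ → ℝ) (x : ℝ) : ℝ :=
  -(f x * g x * deriv f x +
    (green ⋆[ContinuousLinearMap.mul ℝ ℝ, volume] (fun y =>
      3 * f y * g y * deriv f y + 2 * f y * deriv g y * deriv (deriv f) y
        + 2 * (deriv f y) ^ 2 * deriv g y + f y * deriv (deriv g) y * deriv f y)) x)

/-- `(u, v)` is a strong solution on `[0,T)`, in the class `C([0,T); Hˢ × Hˢ)`, of the Cauchy problem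
for the Geng–Xue system with initial data `(u₀, v₀)`. The time derivative at `0` is one-sided.
For `s > 5/2` the right-hand sides are continuous in time with values in `H^{s-1}`, so that the
solution is then also of class `C¹([0,T); H^{s-1} × H^{s-1})`. -/
structure IsStrongSolution (s T : ℝ) (u₀ v₀ : ℝ → ℝ) (u v : ℝ → ℝ → ℝ) : Prop where
  regular_u : ContinuousInHs s T u
  regular_v : ContinuousInHs s T v
  init_u : u 0 = u₀
  init_v : v 0 = v₀
  eq_u : ∀ t ∈ Ico 0 T, ∀ x, HasDerivWithinAt (fun τ => u τ x) (rhs (u t) (v t) x) (Ico 0 T) t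
  eq_v : ∀ t ∈ Ico 0 T, ∀ x, HasDerivWithinAt (fun τ => v τ x) (rhs (v t) (u t) x) (Ico 0 T) t

/-- The maximal existence time in `[0, ∞]`: the supremum of all `T > 0` such that a strong solution
exists on `[0,T)`. -/
def maximalTime (s : ℝ) (u₀ v₀ : ℝ → ℝ) : ℝ≥0∞ :=
  sSup {τ | ∃ T : ℝ, 0 < T ∧ τ = ENNReal.ofReal T ∧ ∃ u v, IsStrongSolution s T u₀ v₀ u v}

/-- `q` is the characteristic, on `[0,T)`, of the velocity field `u v` that starts at `x₀`. -/
def IsCharacteristic (T : ℝ) (u v : ℝ → ℝ → ℝ) (x₀ : ℝ) (q : ℝ → ℝ) : Prop :=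
  q 0 = x₀ ∧ ∀ t ∈ Ico 0 T, HasDerivWithinAt q (u t (q t) * v t (q t)) (Ico 0 T) t

/-- `f ∈ W^{1,1}(ℝ)`, for functions of class `C¹`. -/
def MemW11 (f : ℝ → ℝ) : Prop :=
  ContDiff ℝ 1 f ∧ Integrable f ∧ Integrable (deriv f)

/-- The norm of `W^{1,1}(ℝ)`, for functions of class `C¹`. -/
def normW11 (f : ℝ → ℝ) : ℝ := (∫ x, |f x|) + ∫ x, |deriv f x|

/-- The `L^∞` norm of `n = f - f''`. -/
def normMomentum (f : ℝ → ℝ) : ℝ :=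
  (eLpNorm (fun x => f x - deriv (deriv f) x) ⊤ volume).toReal

/-- `‖n₀‖_{L^∞} + ‖u₀‖_{W^{1,1}}`, where `n₀ = v₀ - v₀''`. -/
def size (u₀ v₀ : ℝ → ℝ) : ℝ := normMomentum v₀ + normW11 u₀

/-- `b₁ = (4 / v₀(x₀)) (‖n₀‖ + ‖u₀‖)⁴ + 14 (‖n₀‖ + ‖u₀‖)³`. -/
def b₁ (u₀ v₀ : ℝ → ℝ) (x₀ : ℝ) : ℝ :=
  4 / v₀ x₀ * size u₀ v₀ ^ 4 + 14 * size u₀ v₀ ^ 3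

/-- `T₂ = v₀(x₀) / (80 (‖u₀‖ + ‖n₀‖)³)`. -/
def T₂ (u₀ v₀ : ℝ → ℝ) (x₀ : ℝ) : ℝ := v₀ x₀ / (80 * size u₀ v₀ ^ 3)

/-- The explicit upper bound for the blow-up time. -/
def T₀ (u₀ v₀ : ℝ → ℝ) (x₀ : ℝ) : ℝ :=
  1 / √(b₁ u₀ v₀ x₀ * v₀ x₀) *
    Real.log ((√(v₀ x₀) * deriv u₀ x₀ - √(b₁ u₀ v₀ x₀)) /
      (√(v₀ x₀) * deriv u₀ x₀ + √(b₁ u₀ v₀ x₀)))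

end

end GengXue

/-! Blow-up follows from a priori estimates for an arbitrary strong solution on `[0,T)`; they force
`T ≤ (10/11) T₀`, and `T*` is the supremum of such `T`.

Integration by parts turns the source of the first equation into `p * (3uvu_x - u v_xx u_x) + p' *
(2 u u_x v_x)`. With `F = p' * (3uvu_x - u v_xx u_x) + p * (2 u u_x v_x)`, the slope `w = u_x` obeys
`w' = -v w² + u v_x w - F` along the characteristics `q' = uv` (`slope_along`). This is a Riccati
equation, provided that `v` stays positive and the other terms stay bounded.

The bounds come from two quantities that control each other: the total variation of `u` and the
supremum of `n = v - v_xx`. If both are at most `A`, then `|u| ≤ A/2`, `|v|, |v_x| ≤ A` and `|v_xx|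
≤ 2A`, whence `|F| ≤ (7/4) A³`. With `J = q_x`, the product `u_x J` solves a linear equation with
coefficient `2 u v_x` (`weighted_slope_along`), and `n' = -3 u v_x n` along characteristics
(`momentum_along`). Neither rate contains the supremum of `u_x`, which is the quantity that is about
to blow up. Since `v₀(x₀) ≤ M`, one has `M² T₂ ≤ 1/80`, and a continuation argument keeps both
quantities below `(3/2) M` up to `T₂` (`controlled_of_short_time`).

On that interval the nonlocal term of the second equation is at most `(7/2) ((3/2) M)³`
(`abs_nonloc_le`), so `v ≥ (17/20) v₀(x₀)` on the characteristic from `x₀`. Therefore `w' ≤ -(11/10)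
(v₀(x₀) w² - b₁) / 2` (`slopeRate_le`). Put `y = √(b₁/v₀(x₀))` and `κ = √(b₁ v₀(x₀))`. The
hypothesis places `w(0)` below `-y`; there `log ((w-y)/(w+y))` is positive, starts at `κ T₀` and
falls at rate at least `(11/10) κ` (`riccati_comparison`), so it cannot last beyond `(10/11) T₀`.
The spare factor `11/10` yields the strict inequality `T* < T₂`. -/

namespace GengXue

/-! ### Sobolev embedding for Bessel potential spaces through Fourier inversion. -/

section Sobolev

open FourierTransform TemperedDistribution Filter Topology

theorem fourierInv_eq_vectorFourier (k : ℝ → ℂ) :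
    𝓕⁻ k = VectorFourier.fourierIntegral Real.fourierChar volume (-innerₗ ℝ) k := rfl

theorem continuous_fourierInv_of_integrable {k : ℝ → ℂ} (h1 : Integrable k) :
    Continuous (𝓕⁻ k) := by
  rw [fourierInv_eq_vectorFourier]
  refine VectorFourier.fourierIntegral_continuous Real.continuous_fourierChar ?_ h1
  simp only [LinearMap.neg_apply, innerₗ_apply_apply]
  fun_prop

/-- On `L¹ ∩ L²` the inverse Fourier transform of `L²` is given by the Fourier integral. -/
theorem fourierInv_toLp_ae_eq {k : ℝ → ℂ} (h1 : Integrable k) (h2 : MemLp k 2) :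
    (𝓕⁻ (h2.toLp k) : Lp ℂ 2 (volume : Measure ℝ)) =ᵐ[volume] 𝓕⁻ k := by
  refine ae_eq_of_integral_contDiff_smul_eq
    ((Lp.memLp _).locallyIntegrable (by norm_num))
    (continuous_fourierInv_of_integrable h1).locallyIntegrable ?_
  intro g hg hgs
  have hg₁ : HasCompactSupport (Complex.ofRealCLM ∘ g) := hgs.comp_left rfl
  have hg₂ : ContDiff ℝ (⊤ : ℕ∞) (Complex.ofRealCLM ∘ g) := by fun_prop
  set φ : 𝓢(ℝ, ℂ) := hg₁.toSchwartzMap hg₂ with hφ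
  have e1 : ∫ x, g x • (𝓕⁻ (h2.toLp k) : Lp ℂ 2 (volume : Measure ℝ)) x
      = Lp.toTemperedDistribution (𝓕⁻ (h2.toLp k)) φ := by
    rw [Lp.toTemperedDistribution_apply]
    simp [hφ]
  -- The inverse transform moves onto the test function by definition on the distribution side, and
  -- back onto `k` by Fubini on the integral side.
  rw [e1, ← Lp.fourierInv_toTemperedDistribution_eq, TemperedDistribution.fourierInv_apply,
    Lp.toTemperedDistribution_apply]
  have e2 : ∫ x, (𝓕⁻ φ) x • (h2.toLp k) x = ∫ x, (𝓕⁻ φ) x • k x := by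
    refine integral_congr_ae ?_
    filter_upwards [h2.coeFn_toLp] with x hx
    rw [hx]
  rw [e2]
  have e3 := VectorFourier.integral_fourierIntegral_smul_eq_flip (L := -innerₗ ℝ) (μ := volume)
    (ν := volume) Real.continuous_fourierChar
    (by simp only [LinearMap.neg_apply, innerₗ_apply_apply]; fun_prop) φ.integrable h1
  have e5 : (-innerₗ ℝ : ℝ →ₗ[ℝ] ℝ →ₗ[ℝ] ℝ).flip = -innerₗ ℝ := by
    ext; simp
  rw [e5, ← fourierInv_eq_vectorFourier, ← fourierInv_eq_vectorFourier] at e3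
  have e4 : (∫ x, (𝓕⁻ φ) x • k x) = ∫ x, φ x • (𝓕⁻ k) x := by
    simpa [SchwartzMap.fourierInv_coe] using e3
  rw [e4]
  simp [hφ]

theorem hasDerivAt_fourierInv {k : ℝ → ℂ} (h : Integrable k)
    (h' : Integrable (fun x : ℝ => x • k x)) (w : ℝ) :
    HasDerivAt (𝓕⁻ k) (𝓕⁻ (fun x : ℝ => (2 * Real.pi * Complex.I) • (x • k x)) w) w := by
  have e : 𝓕⁻ k = fun w => 𝓕 k (-w) := by
    ext w; exact Real.fourierInv_eq_fourier_neg k w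
  have h1 := (Real.hasDerivAt_fourier h h' (-w)).scomp w (hasDerivAt_neg w)
  rw [e, Real.fourierInv_eq_fourier_neg]
  convert! h1 using 1
  rw [neg_one_smul, Real.fourier_eq, Real.fourier_eq, ← integral_neg]
  congr 1
  ext v
  rw [← smul_neg]
  congr 1
  simp only [Complex.real_smul, smul_eq_mul]
  ring

/-- Undoing the potential on the Fourier side gives an identity of tempered distributions. For `s ≥
0` the multiplier is bounded by `1`, so both sides come from `L²` functions, and `L²` embeds
injectively into the distributions. -/
theorem fourier_of_hasBessel {s : ℝ} (hs : 0 ≤ s) {f : ℝ → ℝ}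
    {g : Lp ℂ 2 (volume : Measure ℝ)} (hf : MemLp (fun x => (f x : ℂ)) 2 (volume : Measure ℝ))
    (h : TemperedDistribution.besselPotential ℝ ℂ s (hf.toLp _ : 𝓢'(ℝ, ℂ)) = (g : 𝓢'(ℝ, ℂ))) :
    (𝓕 (hf.toLp _) : Lp ℂ 2 (volume : Measure ℝ)) =ᵐ[volume]
      fun x => (((1 + ‖x‖ ^ 2) ^ (-s / 2) : ℝ) : ℂ) * (𝓕 g : Lp ℂ 2 (volume : Measure ℝ)) x := by
  have h' := (besselPotential_neg_apply_eq_iff s _ _).2 h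
  apply_fun 𝓕 at h'
  rw [fourier_besselPotential_eq_smulLeftCLM_fourier_apply,
    Lp.fourier_toTemperedDistribution_eq, Lp.fourier_toTemperedDistribution_eq] at h'
  set m : ℝ → ℂ := fun x => (((1 + ‖x‖ ^ 2) ^ (-s / 2) : ℝ) : ℂ) with hm
  have hmt : m.HasTemperateGrowth := by fun_prop
  have hb : ∀ x, ‖m x‖ ≤ 1 := by
    intro x
    rw [hm, Complex.norm_real, Real.norm_eq_abs, abs_eq_self.mpr (by positivity)]
    exact Real.rpow_le_one_of_one_le_of_nonpos (by simp; positivity) (by linarith)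
  have hml : MemLp m ⊤ (volume : Measure ℝ) :=
    memLp_top_of_bound hmt.1.continuous.aestronglyMeasurable 1 (ae_of_all _ hb)
  rw [← Lp.toTemperedDistribution_smul_eq (r := 2) hmt hml] at h'
  have hinj := LinearMap.ker_eq_bot.1
    (Lp.ker_toTemperedDistributionCLM_eq_bot (F := ℂ) (μ := (volume : Measure ℝ)) (p := 2))
  have h2 := hinj (a₁ := (hml.toLp m) • (𝓕 g : Lp ℂ 2 (volume : Measure ℝ))) h'
  rw [← h2]
  filter_upwards [Lp.coeFn_lpSMul (r := 2) (hml.toLp m) (𝓕 g : Lp ℂ 2 (volume : Measure ℝ)),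
    hml.coeFn_toLp] with x h3 h4
  rw [h3, Pi.smul_apply', h4, smul_eq_mul]


theorem norm_fourierInv_le (k : ℝ → ℂ) (x : ℝ) : ‖𝓕⁻ k x‖ ≤ ∫ ξ, ‖k ξ‖ :=
  VectorFourier.norm_fourierIntegral_le_integral_norm _ _ _ _ _

theorem tendsto_fourierInv_cocompact (k : ℝ → ℂ) :
    Tendsto (𝓕⁻ k) (cocompact ℝ) (𝓝 0) := by
  have e : 𝓕⁻ k = 𝓕 (fun x => k (-x)) := by
    rw [Real.fourierInv_eq_fourier_comp_neg]
  rw [e]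
  exact Real.zero_at_infty_fourier _

theorem eLpNorm_fourierInv {k : ℝ → ℂ} (h1 : Integrable k) (h2 : MemLp k 2) :
    eLpNorm (𝓕⁻ k) 2 = eLpNorm k 2 := by
  rw [← eLpNorm_congr_ae (fourierInv_toLp_ae_eq h1 h2), ← eLpNorm_congr_ae h2.coeFn_toLp,
    ← Lp.enorm_def, ← Lp.enorm_def]
  have h := (Lp.fourierTransformₗᵢ ℝ ℂ).symm.norm_map (h2.toLp k)
  rw [← ofReal_norm, ← ofReal_norm]
  exact congrArg _ h

theorem memLp_bessel_weight {r : ℝ} (hr : 1 / 2 < r) :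
    MemLp (fun x : ℝ => (1 + ‖x‖ ^ 2) ^ (-r / 2)) 2 := by
  have hc : Continuous (fun x : ℝ => (1 + ‖x‖ ^ 2) ^ (-r / 2)) := by
    have : (fun x : ℝ => (1 + ‖x‖ ^ 2) ^ (-r / 2)).HasTemperateGrowth := by fun_prop
    exact this.1.continuous
  rw [memLp_two_iff_integrable_sq hc.aestronglyMeasurable]
  have h := integrable_rpow_neg_one_add_norm_sq (E := ℝ) (μ := volume) (r := 2 * r)
    (by simp; linarith)
  refine h.congr (ae_of_all _ fun x => ?_)
  simp only
  rw [← Real.rpow_mul_natCast (by positivity)]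
  congr 1
  push_cast
  ring

/-- The Sobolev embedding `Hˢ(ℝ) ⊂ C²` for `s > 5/2`, with quantitative bounds. -/
theorem exists_sobolev_bound {s : ℝ} (hs : 5 / 2 < s) :
    ∃ C : ℝ, 0 ≤ C ∧ ∀ (f : ℝ → ℝ) (g : Lp ℂ 2 (volume : Measure ℝ)),
      Continuous f → HasBessel s f g →
      (∀ x, HasDerivAt f (deriv f x) x) ∧
      (∀ x, HasDerivAt (deriv f) (deriv (deriv f) x) x) ∧
      Continuous (deriv (deriv f)) ∧
      (∀ x, |f x| ≤ C * ‖g‖) ∧ (∀ x, |deriv f x| ≤ C * ‖g‖) ∧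
      (∀ x, |deriv (deriv f) x| ≤ C * ‖g‖) ∧
      eLpNorm f 2 ≤ ENNReal.ofReal (C * ‖g‖) ∧ eLpNorm (deriv f) 2 ≤ ENNReal.ofReal (C * ‖g‖) ∧
      Tendsto f (cocompact ℝ) (𝓝 0) := by
  have hw := memLp_bessel_weight (r := s - 2) (by linarith)
  set w : ℝ → ℝ := fun x : ℝ => (1 + ‖x‖ ^ 2) ^ (-(s - 2) / 2) with hwdef
  set A : ℝ := (eLpNorm w 2).toReal with hA
  have hA0 : 0 ≤ A := ENNReal.toReal_nonneg
  -- Each derivative costs a factor `2π`. The summand `A` serves the supremum bounds (Cauchy–Schwarz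
  -- against the weight), the summand `1` the `L²` bounds (Plancherel).
  refine ⟨(2 * Real.pi) ^ 2 * (A + 1), by positivity, ?_⟩
  rintro f g hfc ⟨hf, hfg⟩
  have hG := fourier_of_hasBessel (by linarith) hf hfg
  set G : Lp ℂ 2 (volume : Measure ℝ) := 𝓕 g with hGdef
  have hGn : ‖G‖ = ‖g‖ := Lp.norm_fourier_eq g
  set H : ℝ → ℂ := ⇑(𝓕 (hf.toLp _) : Lp ℂ 2 (volume : Measure ℝ)) with hH
  have hH2 : MemLp H 2 := Lp.memLp _
  -- pointwise bounds of `H`, `ξ H`, `ξ² H`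
  have hpt : ∀ᵐ x, ‖H x‖ ≤ ‖w x * ‖G x‖‖ ∧ ‖x • H x‖ ≤ ‖w x * ‖G x‖‖ ∧
      ‖x • (x • H x)‖ ≤ ‖w x * ‖G x‖‖ ∧ ‖x • H x‖ ≤ ‖G x‖ ∧ ‖H x‖ ≤ ‖G x‖ := by
    filter_upwards [hG] with x hx
    have e0 : (0 : ℝ) < 1 + ‖x‖ ^ 2 := by positivity
    -- The split-off factor `1 + ξ²` dominates `1`, `|ξ|` and `ξ²`; what remains, `w`, is square
    -- integrable because `s - 2 > 1/2`.
    have e1 : w x = (1 + ‖x‖ ^ 2) * (1 + ‖x‖ ^ 2) ^ (-s / 2) := by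
      simp only [hwdef]
      conv_rhs => rw [← Real.rpow_one_add' e0.le (by linarith)]
      congr 1
      ring
    set m : ℝ := (1 + ‖x‖ ^ 2) ^ (-s / 2) with hm
    have hm0 : 0 ≤ m := by positivity
    have hm1 : (1 + ‖x‖ ^ 2) * m ≤ 1 := by
      rw [← e1]
      exact Real.rpow_le_one_of_one_le_of_nonpos (by simp; positivity) (by linarith)
    have hHx : ‖H x‖ = m * ‖G x‖ := by
      rw [hx, norm_mul, Complex.norm_real, Real.norm_eq_abs, abs_of_nonneg hm0]
    have hwx : ‖w x * ‖G x‖‖ = (1 + ‖x‖ ^ 2) * (m * ‖G x‖) := by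
      rw [e1, Real.norm_eq_abs, abs_of_nonneg (by positivity)]
      ring
    have hx1 : ‖x‖ ≤ 1 + ‖x‖ ^ 2 := by nlinarith [sq_nonneg (‖x‖ - 1)]
    have hmG : 0 ≤ m * ‖G x‖ := by positivity
    have hle : (1 + ‖x‖ ^ 2) * (m * ‖G x‖) ≤ ‖G x‖ := by
      rw [← mul_assoc]
      exact mul_le_of_le_one_left (norm_nonneg _) hm1
    have h1 : ‖x • H x‖ ≤ (1 + ‖x‖ ^ 2) * (m * ‖G x‖) := by
      rw [norm_smul, hHx]
      gcongr
    have h0 : ‖H x‖ ≤ (1 + ‖x‖ ^ 2) * (m * ‖G x‖) := by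
      rw [hHx]
      nlinarith [sq_nonneg ‖x‖]
    refine ⟨hwx ▸ h0, hwx ▸ h1, ?_, h1.trans hle, h0.trans hle⟩
    rw [hwx, norm_smul, norm_smul, hHx, ← mul_assoc]
    gcongr
    nlinarith
  have hwG : Integrable (fun x => w x * ‖G x‖) := by
    have := MemLp.integrable_mul hw (Lp.memLp G).norm
    exact this
  have hwGn : ∫ x, ‖w x * ‖G x‖‖ ≤ A * ‖g‖ := by
    have h1 := eLpNorm_smul_le_mul_eLpNorm (p := 2) (q := 2) (r := 1)
      (Lp.memLp G).norm.aestronglyMeasurable hw.aestronglyMeasurable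
    rw [integral_norm_eq_lintegral_enorm hwG.aestronglyMeasurable, ← eLpNorm_one_eq_lintegral_enorm,
      ← hGn, Lp.norm_def, hA, ← ENNReal.toReal_mul]
    refine ENNReal.toReal_mono (ENNReal.mul_ne_top hw.2.ne (Lp.memLp G).2.ne) ?_
    rw [eLpNorm_norm] at h1
    exact h1
  have hxm : AEStronglyMeasurable (fun x : ℝ => x • H x) := by
    exact (continuous_id.aestronglyMeasurable).smul hH2.1
  have hxxm : AEStronglyMeasurable (fun x : ℝ => x • (x • H x)) := by
    exact (continuous_id.aestronglyMeasurable).smul hxm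
  have i0 : Integrable H := hwG.mono hH2.1 (hpt.mono fun x h => h.1)
  have i1 : Integrable (fun x : ℝ => x • H x) := hwG.mono hxm (hpt.mono fun x h => h.2.1)
  have i2 : Integrable (fun x : ℝ => x • (x • H x)) :=
    hwG.mono hxxm (hpt.mono fun x h => h.2.2.1)
  have n0 : ∫ x, ‖H x‖ ≤ A * ‖g‖ :=
    (integral_mono_ae i0.norm hwG.norm (hpt.mono fun x h => h.1)).trans hwGn
  have n1 : ∫ x, ‖x • H x‖ ≤ A * ‖g‖ :=
    (integral_mono_ae i1.norm hwG.norm (hpt.mono fun x h => h.2.1)).trans hwGn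
  have n2 : ∫ x, ‖x • (x • H x)‖ ≤ A * ‖g‖ :=
    (integral_mono_ae i2.norm hwG.norm (hpt.mono fun x h => h.2.2.1)).trans hwGn
  set c : ℂ := 2 * Real.pi * Complex.I with hc
  have hcn : ‖c‖ = 2 * Real.pi := by
    simp [hc, abs_of_pos Real.pi_pos]
  have hπ : 1 ≤ 2 * Real.pi := by linarith [Real.pi_gt_three]
  -- `f` is the inverse Fourier transform of `H`
  have hfe : (fun x => (f x : ℂ)) = 𝓕⁻ H := by
    refine Continuous.ae_eq_iff_eq volume (by fun_prop)
      (continuous_fourierInv_of_integrable i0) |>.1 ?_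
    have h1 := fourierInv_toLp_ae_eq i0 hH2
    have h2 : hH2.toLp H = 𝓕 (hf.toLp _) := Lp.toLp_coeFn _ _
    rw [h2, fourierInv_fourier_eq] at h1
    exact hf.coeFn_toLp.symm.trans h1
  have k1 : (fun x : ℝ => x • (c • (x • H x))) = fun x : ℝ => c • (x • (x • H x)) := by
    ext x; rw [smul_comm]
  have ic1 : Integrable (fun x : ℝ => c • (x • H x)) := i1.smul c
  have ic2 : Integrable (fun x : ℝ => x • (c • (x • H x))) := by
    rw [k1]; exact i2.smul c
  have d1 : ∀ x, HasDerivAt (fun x => (f x : ℂ)) (𝓕⁻ (fun x : ℝ => c • (x • H x)) x) x := by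
    rw [hfe]
    exact fun x => hasDerivAt_fourierInv i0 i1 x
  have d1' : ∀ x, HasDerivAt f (𝓕⁻ (fun x : ℝ => c • (x • H x)) x).re x := by
    intro x
    have := Complex.reCLM.hasFDerivAt.comp_hasDerivAt x (d1 x)
    simpa using! this
  have hd1 : deriv f = fun x => (𝓕⁻ (fun x : ℝ => c • (x • H x)) x).re :=
    funext fun x => (d1' x).deriv
  have d2 : ∀ x, HasDerivAt (deriv f)
      (𝓕⁻ (fun x : ℝ => c • (x • (c • (x • H x)))) x).re x := by
    intro x
    rw [hd1]
    have := Complex.reCLM.hasFDerivAt.comp_hasDerivAt x (hasDerivAt_fourierInv ic1 ic2 x)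
    simpa using! this
  have hd2 : deriv (deriv f) = fun x => (𝓕⁻ (fun x : ℝ => c • (x • (c • (x • H x)))) x).re :=
    funext fun x => (d2 x).deriv
  have hπ2 : 2 * Real.pi ≤ (2 * Real.pi) ^ 2 := by nlinarith
  have hCA : (2 * Real.pi) * (A + 1) ≤ (2 * Real.pi) ^ 2 * (A + 1) := by gcongr
  have hCg : A * ‖g‖ ≤ (2 * Real.pi) ^ 2 * (A + 1) * ‖g‖ := by
    refine mul_le_mul_of_nonneg_right (le_trans ?_ hCA) (norm_nonneg g)
    nlinarith
  have hCg1 : (2 * Real.pi) * (A * ‖g‖) ≤ (2 * Real.pi) ^ 2 * (A + 1) * ‖g‖ := by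
    rw [← mul_assoc]
    refine mul_le_mul_of_nonneg_right (le_trans ?_ hCA) (norm_nonneg g)
    nlinarith
  have hCg2 : (2 * Real.pi) * ‖g‖ ≤ (2 * Real.pi) ^ 2 * (A + 1) * ‖g‖ := by
    refine mul_le_mul_of_nonneg_right (le_trans ?_ hCA) (norm_nonneg g)
    nlinarith
  have hGe : eLpNorm G 2 = ENNReal.ofReal ‖g‖ := by
    rw [← hGn, ofReal_norm, Lp.enorm_def]
  refine ⟨fun x => (d1' x).differentiableAt.hasDerivAt, fun x => (d2 x).differentiableAt.hasDerivAt,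
    ?_, ?_, ?_, ?_, ?_, ?_, ?_⟩
  · rw [hd2]
    exact Complex.continuous_re.comp (continuous_fourierInv_of_integrable (ic2.smul c))
  · intro x
    have h1 : ‖(f x : ℂ)‖ ≤ _ := (congrFun hfe x) ▸ norm_fourierInv_le H x
    rw [Complex.norm_real, Real.norm_eq_abs] at h1
    exact h1.trans (n0.trans hCg)
  · intro x
    rw [hd1]
    refine (Complex.abs_re_le_norm _).trans ((norm_fourierInv_le _ x).trans ?_)
    simp only [norm_smul c, integral_const_mul, hcn]
    exact (mul_le_mul_of_nonneg_left n1 (by positivity)).trans hCg1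
  · intro x
    rw [hd2]
    refine (Complex.abs_re_le_norm _).trans ((norm_fourierInv_le _ x).trans ?_)
    have e : ∀ x : ℝ, ‖c • (x • (c • (x • H x)))‖ = (2 * Real.pi) ^ 2 * ‖x • (x • H x)‖ := by
      intro x
      rw [smul_comm x c, norm_smul, norm_smul, hcn]
      ring
    simp only [e, integral_const_mul]
    rw [mul_assoc]
    gcongr
    exact n2.trans (by gcongr; linarith)
  · have e : eLpNorm f 2 = eLpNorm (fun x => (f x : ℂ)) 2 := by
      refine eLpNorm_congr_norm_ae (ae_of_all _ fun x => ?_)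
      simp
    rw [e, hfe, eLpNorm_fourierInv i0 hH2]
    refine (eLpNorm_mono_ae (hpt.mono fun x h => h.2.2.2.2)).trans ?_
    rw [hGe]
    refine ENNReal.ofReal_le_ofReal (le_trans ?_ hCg2)
    nlinarith [norm_nonneg g]
  · have m2 : MemLp (fun x : ℝ => c • (x • H x)) 2 :=
      MemLp.const_smul ((Lp.memLp G).mono hxm (hpt.mono fun x h => h.2.2.2.1)) c
    have e : eLpNorm (deriv f) 2 ≤ eLpNorm (𝓕⁻ (fun x : ℝ => c • (x • H x))) 2 := by
      refine eLpNorm_mono_ae (ae_of_all _ fun x => ?_)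
      rw [hd1]
      exact Complex.abs_re_le_norm _
    refine e.trans ?_
    rw [eLpNorm_fourierInv ic1 m2]
    refine (eLpNorm_le_mul_eLpNorm_of_ae_le_mul (c := 2 * Real.pi) (g := G) ?_ 2).trans ?_
    · filter_upwards [hpt] with x hx
      rw [norm_smul, hcn]
      exact mul_le_mul_of_nonneg_left hx.2.2.2.1 (by positivity)
    · rw [hGe, ← ENNReal.ofReal_mul (by positivity)]
      exact ENNReal.ofReal_le_ofReal hCg2
  · have h := tendsto_fourierInv_cocompact H
    rw [← hfe] at h
    have := (Complex.continuous_re.tendsto 0).comp h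
    simpa using! this

/-- Used to apply the Sobolev bound to differences of two time slices. -/
theorem HasBessel.sub {s : ℝ} {f f' : ℝ → ℝ} {g g' : Lp ℂ 2 (volume : Measure ℝ)}
    (h : HasBessel s f g) (h' : HasBessel s f' g') :
    HasBessel s (fun x => f x - f' x) (g - g') := by
  obtain ⟨hf, h⟩ := h
  obtain ⟨hf', h'⟩ := h'
  have e : (fun x => ((f x - f' x : ℝ) : ℂ)) = (fun x => (f x : ℂ)) - fun x => (f' x : ℂ) := by
    ext x; simp
  refine ⟨e ▸ hf.sub hf', ?_⟩
  have e2 : (MemLp.toLp _ (e ▸ hf.sub hf' :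
      MemLp (fun x => ((f x - f' x : ℝ) : ℂ)) 2 (volume : Measure ℝ))) = hf.toLp _ - hf'.toLp _ := by
    rw [← MemLp.toLp_sub]
    congr 1
  rw [e2, ← Lp.toTemperedDistributionCLM_apply, ← Lp.toTemperedDistributionCLM_apply, map_sub,
    map_sub, map_sub, Lp.toTemperedDistributionCLM_apply, Lp.toTemperedDistributionCLM_apply,
    Lp.toTemperedDistributionCLM_apply, Lp.toTemperedDistributionCLM_apply, h, h']

end Sobolev

end GengXue

namespace GengXue

/-! ### Convolution with the Green function and its derivative. -/

section Kernel

open Filter Topology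

/-- The (almost everywhere defined) derivative of the Green function. -/
noncomputable def greenD (x : ℝ) : ℝ := if 0 < x then -green x else green x

/-- Convolution with an integrable kernel, as a plain integral. -/
noncomputable def conv (k f : ℝ → ℝ) (x : ℝ) : ℝ := ∫ y, k y * f (x - y)

/-- Measurable kernels dominated by the Green function. -/
structure IsKernel (k : ℝ → ℝ) : Prop where
  measurable : Measurable k
  abs_le : ∀ y, |k y| ≤ green y

theorem continuous_green : Continuous green := by
  unfold green; fun_prop

theorem green_nonneg (x : ℝ) : 0 ≤ green x := by unfold green; positivity

theorem green_le_half (x : ℝ) : green x ≤ 1 / 2 := by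
  unfold green
  have : Real.exp (-|x|) ≤ 1 := Real.exp_le_one_iff.2 (by simp)
  linarith

theorem integrable_green : Integrable green := by
  have h : Integrable (fun x : ℝ => Real.exp (-|x|)) := by
    refine not_imp_comm.1 integral_undef ?_
    rw [integral_comp_abs (f := fun x => Real.exp (-x)), integral_exp_neg_Ioi_zero]
    norm_num
  exact h.div_const 2

theorem integral_green : ∫ x, green x = 1 := by
  unfold green
  rw [integral_div, integral_comp_abs (f := fun x => Real.exp (-x)), integral_exp_neg_Ioi_zero]
  norm_num

theorem isKernel_green : IsKernel green :=
  ⟨continuous_green.measurable, fun y => (abs_of_nonneg (green_nonneg y)).le⟩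

theorem isKernel_greenD : IsKernel greenD := by
  refine ⟨Measurable.ite measurableSet_Ioi continuous_green.measurable.neg
    continuous_green.measurable, fun y => ?_⟩
  unfold greenD
  split_ifs <;> simp [abs_of_nonneg (green_nonneg y)]

variable {k : ℝ → ℝ}

theorem IsKernel.norm_mul_le (hk : IsKernel k) {C z : ℝ} (hz : |z| ≤ C) (y : ℝ) :
    ‖k y * z‖ ≤ C * green y := by
  rw [Real.norm_eq_abs, abs_mul, mul_comm]
  exact mul_le_mul hz (hk.abs_le y) (abs_nonneg _) ((abs_nonneg _).trans hz)

theorem IsKernel.integrable (hk : IsKernel k) {f : ℝ → ℝ} (hf : Continuous f) {C : ℝ}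
    (hC : ∀ x, |f x| ≤ C) (x : ℝ) : Integrable (fun y => k y * f (x - y)) :=
  (integrable_green.const_mul C).mono'
    (hk.measurable.aestronglyMeasurable.mul (by fun_prop))
    (ae_of_all _ fun y => hk.norm_mul_le (hC _) y)

theorem IsKernel.abs_conv_le (hk : IsKernel k) {f : ℝ → ℝ} {C : ℝ} (hC : ∀ x, |f x| ≤ C)
    (x : ℝ) : |conv k f x| ≤ C := by
  have h := norm_integral_le_of_norm_le (integrable_green.const_mul C)
    (ae_of_all _ fun y => hk.norm_mul_le (hC (x - y)) y)
  rwa [integral_const_mul, integral_green, mul_one] at h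

theorem IsKernel.conv_add (hk : IsKernel k) {f g : ℝ → ℝ} (hf : Continuous f) (hg : Continuous g)
    {C D : ℝ} (hC : ∀ x, |f x| ≤ C) (hD : ∀ x, |g x| ≤ D) (x : ℝ) :
    conv k (fun y => f y + g y) x = conv k f x + conv k g x := by
  unfold conv
  rw [← integral_add (hk.integrable hf hC x) (hk.integrable hg hD x)]
  simp only [mul_add]

theorem IsKernel.continuous_conv (hk : IsKernel k) {f : ℝ → ℝ → ℝ}
    (hf : Continuous fun p : ℝ × ℝ => f p.1 p.2) {C : ℝ} (hC : ∀ t x, |f t x| ≤ C) :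
    Continuous fun p : ℝ × ℝ => conv k (f p.1) p.2 := by
  unfold conv
  refine continuous_of_dominated (bound := fun y => C * green y) (fun p => ?_)
    (fun p => ae_of_all _ fun y => hk.norm_mul_le (hC _ _) y) (integrable_green.const_mul C)
    (ae_of_all _ fun y => ?_)
  · refine hk.measurable.aestronglyMeasurable.mul ?_
    have : Continuous fun y => f p.1 (p.2 - y) :=
      hf.comp (f := fun y : ℝ => (p.1, p.2 - y)) (by fun_prop)
    exact this.aestronglyMeasurable
  · have : Continuous fun p : ℝ × ℝ => f p.1 (p.2 - y) :=
      hf.comp (f := fun p : ℝ × ℝ => (p.1, p.2 - y)) (by fun_prop)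
    exact continuous_const.mul this

/-- Young's inequality `L^∞ * L¹ ⊂ L^∞`, where the kernel has supremum at most `1/2`. -/
theorem IsKernel.abs_conv_le_of_lintegral (hk : IsKernel k) {f g : ℝ → ℝ} {c A : ℝ}
    (hc : 0 ≤ c) (hA : 0 ≤ A) (h : ∀ y, |f y| ≤ c * |g y|)
    (hg : ∫⁻ y, ENNReal.ofReal |g y| ≤ ENNReal.ofReal A) (x : ℝ) :
    |conv k f x| ≤ c * A / 2 := by
  have h1 : ‖conv k f x‖ₑ ≤ ENNReal.ofReal (c * A / 2) := by
    unfold conv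
    refine (enorm_integral_le_lintegral_enorm _).trans ?_
    calc ∫⁻ y, ‖k y * f (x - y)‖ₑ
        ≤ ∫⁻ y, ENNReal.ofReal (c / 2) * ENNReal.ofReal |g (x - y)| := by
          refine lintegral_mono fun y => ?_
          rw [← ofReal_norm, ← ENNReal.ofReal_mul (by positivity), Real.norm_eq_abs, abs_mul]
          refine ENNReal.ofReal_le_ofReal ?_
          calc |k y| * |f (x - y)| ≤ 1 / 2 * (c * |g (x - y)|) :=
                mul_le_mul ((hk.abs_le y).trans (green_le_half y)) (h _) (abs_nonneg _)
                  (by norm_num)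
            _ = _ := by ring
      _ = ENNReal.ofReal (c / 2) * ∫⁻ y, ENNReal.ofReal |g y| := by
          rw [lintegral_const_mul' _ _ ENNReal.ofReal_ne_top,
            lintegral_sub_left_eq_self (fun y => ENNReal.ofReal |g y|) x]
      _ ≤ ENNReal.ofReal (c / 2) * ENNReal.ofReal A := by gcongr
      _ = _ := by rw [← ENNReal.ofReal_mul (by positivity)]; ring_nf
  rw [← ofReal_norm, ENNReal.ofReal_le_ofReal_iff (by positivity)] at h1
  exact h1

/-- Young's inequality `L¹ * L¹ ⊂ L¹` by Tonelli, the Green function having mass `1`. -/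
theorem IsKernel.lintegral_conv_le (hk : IsKernel k) {f g : ℝ → ℝ} {c A : ℝ}
    (hc : 0 ≤ c) (hgm : Continuous g) (h : ∀ y, |f y| ≤ c * |g y|)
    (hg : ∫⁻ y, ENNReal.ofReal |g y| ≤ ENNReal.ofReal A) :
    ∫⁻ x, ENNReal.ofReal |conv k f x| ≤ ENNReal.ofReal (c * A) := by
  have h1 : ∫⁻ y, ENNReal.ofReal (green y) = 1 := by
    rw [← ofReal_integral_eq_lintegral_ofReal integrable_green (ae_of_all _ green_nonneg),
      integral_green, ENNReal.ofReal_one]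
  calc ∫⁻ x, ENNReal.ofReal |conv k f x|
      ≤ ∫⁻ x, ∫⁻ y, ENNReal.ofReal (green y) * ENNReal.ofReal (c * |g (x - y)|) := by
        refine lintegral_mono fun x => ?_
        rw [← Real.norm_eq_abs, ofReal_norm]
        unfold conv
        refine (enorm_integral_le_lintegral_enorm _).trans (lintegral_mono fun y => ?_)
        rw [← ofReal_norm, ← ENNReal.ofReal_mul (green_nonneg y), Real.norm_eq_abs, abs_mul]
        exact ENNReal.ofReal_le_ofReal (mul_le_mul (hk.abs_le y) (h _) (abs_nonneg _)
          (green_nonneg y))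
    _ = ∫⁻ y, ∫⁻ x, ENNReal.ofReal (green y) * ENNReal.ofReal (c * |g (x - y)|) := by
        refine lintegral_lintegral_swap (Measurable.aemeasurable ?_)
        have := continuous_green
        simp only [Function.uncurry_def]
        fun_prop
    _ = ∫⁻ y, ENNReal.ofReal (green y) * ∫⁻ x, ENNReal.ofReal (c * |g x|) := by
        refine lintegral_congr fun y => ?_
        rw [lintegral_const_mul' _ _ ENNReal.ofReal_ne_top,
          lintegral_sub_right_eq_self (fun x => ENNReal.ofReal (c * |g x|)) y]
    _ = ∫⁻ x, ENNReal.ofReal (c * |g x|) := by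
        rw [lintegral_mul_const _ (by have := continuous_green; fun_prop), h1, one_mul]
    _ = ENNReal.ofReal c * ∫⁻ x, ENNReal.ofReal |g x| := by
        rw [← lintegral_const_mul' _ _ ENNReal.ofReal_ne_top]
        simp only [ENNReal.ofReal_mul hc]
    _ ≤ ENNReal.ofReal c * ENNReal.ofReal A := by gcongr
    _ = _ := by rw [ENNReal.ofReal_mul hc]

/-- The causal half of the convolution with `exp (-|x|)`. -/
noncomputable def convLeft (f : ℝ → ℝ) (x : ℝ) : ℝ := ∫ z in Ioi 0, Real.exp (-z) * f (x - z)

theorem integrableOn_exp_mul {f : ℝ → ℝ} (hf : Continuous f) {C : ℝ} (hC : ∀ x, |f x| ≤ C)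
    (a : ℝ) : IntegrableOn (fun y => Real.exp y * f y) (Iic a) := by
  refine (integrableOn_exp_Iic a |>.const_mul C).mono' (by fun_prop) (ae_of_all _ fun y => ?_)
  rw [Real.norm_eq_abs, abs_mul, Real.abs_exp, mul_comm]
  exact mul_le_mul_of_nonneg_right (hC y) (Real.exp_pos y).le

theorem convLeft_eq (f : ℝ → ℝ) (x : ℝ) :
    convLeft f x = Real.exp (-x) * ∫ y in Iic x, Real.exp y * f y := by
  have h := (Measure.measurePreserving_sub_left (volume : Measure ℝ) x).setIntegral_preimage_emb
    (MeasurableEquiv.subLeft x).measurableEmbedding (fun y => Real.exp y * f y) (Iio x)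
  have e : (fun z => x - z) ⁻¹' Iio x = Ioi 0 := by ext z; simp
  rw [e] at h
  rw [integral_Iic_eq_integral_Iio, ← h, ← integral_const_mul, convLeft]
  refine integral_congr_ae (ae_of_all _ fun z => ?_)
  simp only
  rw [← mul_assoc, ← Real.exp_add]
  ring_nf

/-- Written as `e^{-x} ∫_{-∞}^x e^y f`, the causal half solves `L' = f - L`. Its reflection does the
same with opposite sign; half their sum and half their difference are `p * f` and `p' * f`, so both
are differentiable for merely continuous bounded `f`. -/
theorem hasDerivAt_convLeft {f : ℝ → ℝ} (hf : Continuous f) {C : ℝ} (hC : ∀ x, |f x| ≤ C)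
    (x : ℝ) : HasDerivAt (convLeft f) (f x - convLeft f x) x := by
  have e : convLeft f = fun x => Real.exp (-x) *
      ((∫ y in Iic 0, Real.exp y * f y) + ∫ y in (0 : ℝ)..x, Real.exp y * f y) := by
    ext x
    rw [convLeft_eq, ← intervalIntegral.integral_Iic_sub_Iic (integrableOn_exp_mul hf hC 0)
      (integrableOn_exp_mul hf hC x)]
    ring
  have h1 : HasDerivAt (fun x => Real.exp (-x)) (-Real.exp (-x)) x := by
    simpa using! (hasDerivAt_neg x).exp
  have hc : Continuous (fun y => Real.exp y * f y) := by fun_prop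
  have h2 := (hc.integral_hasStrictDerivAt 0 x).hasDerivAt.const_add
    (∫ y in Iic 0, Real.exp y * f y)
  have h3 := h1.mul h2
  rw [e]
  convert! h3 using 1
  have : Real.exp (-x) * (Real.exp x * f x) = f x := by
    rw [← mul_assoc, ← Real.exp_add]; simp
  rw [this]
  ring

theorem integral_eq_add_reflect {g : ℝ → ℝ} (hg : Integrable g) :
    ∫ y, g y = (∫ y in Ioi 0, g y) + ∫ y in Ioi 0, g (-y) := by
  rw [integral_comp_neg_Ioi, neg_zero, ← integral_add_compl (measurableSet_Ioi (a := (0 : ℝ))) hg,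
    compl_Ioi]

theorem conv_green_eq {f : ℝ → ℝ} (hf : Continuous f) {C : ℝ} (hC : ∀ x, |f x| ≤ C) (x : ℝ) :
    conv green f x = (convLeft f x + convLeft (fun y => f (-y)) (-x)) / 2 := by
  unfold conv
  rw [integral_eq_add_reflect (isKernel_green.integrable hf hC x), convLeft, convLeft, add_div,
    ← integral_div, ← integral_div]
  congr 1 <;>
  · refine setIntegral_congr_fun measurableSet_Ioi fun y hy => ?_
    simp only [green, abs_neg, abs_of_pos (mem_Ioi.1 hy)]
    ring_nf

theorem conv_greenD_eq {f : ℝ → ℝ} (hf : Continuous f) {C : ℝ} (hC : ∀ x, |f x| ≤ C) (x : ℝ) :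
    conv greenD f x = (convLeft (fun y => f (-y)) (-x) - convLeft f x) / 2 := by
  unfold conv
  rw [integral_eq_add_reflect (isKernel_greenD.integrable hf hC x), convLeft, convLeft, sub_div,
    ← integral_div, ← integral_div, sub_eq_neg_add, ← integral_neg]
  congr 1 <;>
  · refine setIntegral_congr_fun measurableSet_Ioi fun y hy => ?_
    have hy' : 0 < y := hy
    simp only [greenD, green, abs_neg, abs_of_pos hy', hy', if_true, Left.neg_pos_iff, hy'.not_gt,
      if_false]
    ring_nf

theorem hasDerivAt_convRight {f : ℝ → ℝ} (hf : Continuous f) {C : ℝ} (hC : ∀ x, |f x| ≤ C)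
    (x : ℝ) : HasDerivAt (fun x => convLeft (fun y => f (-y)) (-x))
      (convLeft (fun y => f (-y)) (-x) - f x) x := by
  have h := (hasDerivAt_convLeft (f := fun y => f (-y)) (by fun_prop) (fun y => hC (-y))
    (-x)).comp x (hasDerivAt_neg x)
  convert! h using 1
  rw [neg_neg]
  ring

theorem hasDerivAt_conv_green {f : ℝ → ℝ} (hf : Continuous f) {C : ℝ} (hC : ∀ x, |f x| ≤ C)
    (x : ℝ) : HasDerivAt (conv green f) (conv greenD f x) x := by
  rw [conv_greenD_eq hf hC, funext (conv_green_eq hf hC)]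
  convert! ((hasDerivAt_convLeft hf hC x).add (hasDerivAt_convRight hf hC x)).div_const 2 using 1
  ring

theorem hasDerivAt_conv_greenD {f : ℝ → ℝ} (hf : Continuous f) {C : ℝ} (hC : ∀ x, |f x| ≤ C)
    (x : ℝ) : HasDerivAt (conv greenD f) (conv green f x - f x) x := by
  rw [conv_green_eq hf hC, funext (conv_greenD_eq hf hC)]
  convert! ((hasDerivAt_convRight hf hC x).sub (hasDerivAt_convLeft hf hC x)).div_const 2 using 1
  ring

/-- Here the derivative falls on `f` instead of the kernel. Uniqueness of the derivative then gives
integration by parts without boundary terms. -/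
theorem IsKernel.hasDerivAt_conv (hk : IsKernel k) {f f' : ℝ → ℝ} {C D : ℝ}
    (hf : ∀ x, HasDerivAt f (f' x) x) (hC : ∀ x, |f x| ≤ C) (hf' : Continuous f')
    (hD : ∀ x, |f' x| ≤ D) (x : ℝ) : HasDerivAt (conv k f) (conv k f' x) x := by
  have hfc : Continuous f := continuous_iff_continuousAt.2 fun x => (hf x).continuousAt
  refine (hasDerivAt_integral_of_dominated_loc_of_deriv_le (F := fun x y => k y * f (x - y))
    (F' := fun x y => k y * f' (x - y)) (bound := fun y => D * green y) (s := univ) univ_mem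
    (Eventually.of_forall fun z => (hk.integrable hfc hC z).aestronglyMeasurable)
    (hk.integrable hfc hC x) (hk.integrable hf' hD x).aestronglyMeasurable
    (ae_of_all _ fun y z _ => hk.norm_mul_le (hD _) y) (integrable_green.const_mul D)
    (ae_of_all _ fun y z _ => ?_)).2
  exact ((hf (z - y)).comp_sub_const z y).const_mul (k y)

/-- `p * f' = p' * f`. -/
theorem conv_green_deriv {f f' : ℝ → ℝ} {C D : ℝ}
    (hf : ∀ x, HasDerivAt f (f' x) x) (hC : ∀ x, |f x| ≤ C) (hf' : Continuous f')
    (hD : ∀ x, |f' x| ≤ D) (x : ℝ) : conv green f' x = conv greenD f x :=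
  (isKernel_green.hasDerivAt_conv hf hC hf' hD x).unique
    (hasDerivAt_conv_green (continuous_iff_continuousAt.2 fun x => (hf x).continuousAt) hC x)

/-- `p' * f' = p * f - f`. -/
theorem conv_greenD_deriv {f f' : ℝ → ℝ} {C D : ℝ}
    (hf : ∀ x, HasDerivAt f (f' x) x) (hC : ∀ x, |f x| ≤ C) (hf' : Continuous f')
    (hD : ∀ x, |f' x| ≤ D) (x : ℝ) : conv greenD f' x = conv green f x - f x :=
  (isKernel_greenD.hasDerivAt_conv hf hC hf' hD x).unique
    (hasDerivAt_conv_greenD (continuous_iff_continuousAt.2 fun x => (hf x).continuousAt) hC x)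

end Kernel

end GengXue

namespace GengXue

/-! ### Scalar linear equations and the flow of a bounded velocity field. -/

section Flow

open Filter Topology

theorem hasDerivWithinAt_Ici_of_Icc {y : ℝ → ℝ} {y' a b t : ℝ}
    (h : HasDerivWithinAt y y' (Icc a b) t) (ht : t ∈ Ico a b) :
    HasDerivWithinAt y y' (Ici t) t :=
  h.mono_of_mem_nhdsWithin (Icc_mem_nhdsGE_of_mem ht)

theorem integral_eq_sub_of_hasDerivWithinAt_Icc {y y' : ℝ → ℝ} {a b s t : ℝ}
    (h : ∀ r ∈ Icc a b, HasDerivWithinAt y (y' r) (Icc a b) r) (hy' : ContinuousOn y' (Icc a b))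
    (hs : a ≤ s) (hst : s ≤ t) (ht : t ≤ b) : ∫ r in s..t, y' r = y t - y s := by
  refine intervalIntegral.integral_eq_sub_of_hasDeriv_right_of_le hst
    (fun r hr => ((h r ⟨hs.trans hr.1, hr.2.trans ht⟩).continuousWithinAt).mono
      (Icc_subset_Icc hs ht)) (fun r hr => ?_)
    (ContinuousOn.intervalIntegrable_of_Icc hst (hy'.mono (Icc_subset_Icc hs ht)))
  exact (hasDerivWithinAt_Ici_of_Icc (h r ⟨hs.trans hr.1.le, hr.2.le.trans ht⟩)
    ⟨hs.trans hr.1.le, hr.2.trans_le ht⟩).mono Ioi_subset_Ici_self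

/-- Variation of constants for a scalar linear equation. -/
theorem linear_ode_formula {y c f : ℝ → ℝ} {a b s t : ℝ} (hc : Continuous c) (hf : Continuous f)
    (h : ∀ r ∈ Icc a b, HasDerivWithinAt y (c r * y r + f r) (Icc a b) r)
    (hs : a ≤ s) (hst : s ≤ t) (ht : t ≤ b) :
    y t = Real.exp (∫ r in s..t, c r) * y s
      + ∫ r in s..t, Real.exp (∫ l in r..t, c l) * f r := by
  have hC : ∀ r, HasDerivAt (fun r => ∫ l in r..t, c l) (-c r) r := fun r =>
    intervalIntegral.integral_hasDerivAt_left (hc.intervalIntegrable _ _)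
      (hc.stronglyMeasurableAtFilter _ _) hc.continuousAt
  have hCc : Continuous (fun r => ∫ l in r..t, c l) :=
    continuous_iff_continuousAt.2 fun r => (hC r).continuousAt
  -- The integrating factor runs from `r` to the final time `t`, so it equals `1` at `r = t`.
  have hz : ∀ r ∈ Icc a b, HasDerivWithinAt (fun r => Real.exp (∫ l in r..t, c l) * y r)
      (Real.exp (∫ l in r..t, c l) * f r) (Icc a b) r := by
    intro r hr
    convert! ((hC r).exp.hasDerivWithinAt).mul (h r hr) using 1
    ring
  have := integral_eq_sub_of_hasDerivWithinAt_Icc hz (by fun_prop) hs hst ht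
  rw [this, intervalIntegral.integral_same, Real.exp_zero]
  ring

theorem linear_ode_bound {y c f : ℝ → ℝ} {a b s t C : ℝ} (hc : Continuous c) (hf : Continuous f)
    (h : ∀ r ∈ Icc a b, HasDerivWithinAt y (c r * y r + f r) (Icc a b) r)
    (hs : a ≤ s) (hst : s ≤ t) (ht : t ≤ b) (hcC : ∀ r ∈ Icc s t, |c r| ≤ C) :
    |y t| ≤ Real.exp (C * (t - s)) * (|y s| + ∫ r in s..t, |f r|) := by
  have hint : ∀ r ∈ Icc s t, Real.exp (∫ l in r..t, c l) ≤ Real.exp (C * (t - s)) := by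
    intro r hr
    refine Real.exp_le_exp.2 ?_
    have h1 : ‖∫ l in r..t, c l‖ ≤ C * |t - r| :=
      intervalIntegral.norm_integral_le_of_norm_le_const fun l hl => by
        rw [uIoc_of_le hr.2] at hl
        exact hcC l ⟨hr.1.trans hl.1.le, hl.2⟩
    have hC0 : 0 ≤ C := (abs_nonneg _).trans (hcC r hr)
    rw [abs_of_nonneg (by linarith [hr.2])] at h1
    refine (le_abs_self _).trans (h1.trans ?_)
    gcongr
    exact hr.1
  have hCc : Continuous (fun r => ∫ l in r..t, c l) := by
    refine continuous_iff_continuousAt.2 fun r => HasDerivAt.continuousAt (f' := -c r) ?_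
    exact intervalIntegral.integral_hasDerivAt_left (hc.intervalIntegrable _ _)
      (hc.stronglyMeasurableAtFilter _ _) hc.continuousAt
  rw [linear_ode_formula hc hf h hs hst ht, mul_add]
  refine (abs_add_le _ _).trans (add_le_add ?_ ?_)
  · rw [abs_mul, Real.abs_exp]
    gcongr
    exact Real.exp_le_exp.1 (hint s ⟨le_rfl, hst⟩)
  · rw [← intervalIntegral.integral_const_mul]
    refine (intervalIntegral.abs_integral_le_integral_abs hst).trans ?_
    refine intervalIntegral.integral_mono_on hst
      (Continuous.intervalIntegrable (by fun_prop) _ _)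
      (Continuous.intervalIntegrable (by fun_prop) _ _) fun r hr => ?_
    rw [abs_mul, Real.abs_exp]
    gcongr
    exact Real.exp_le_exp.1 (hint r hr)

/-- A bounded velocity field with bounded continuous space derivative. -/
structure IsVelocity (b b₁ : ℝ → ℝ → ℝ) (B : ℝ) : Prop where
  cont : Continuous fun p : ℝ × ℝ => b p.1 p.2
  cont₁ : Continuous fun p : ℝ × ℝ => b₁ p.1 p.2
  deriv : ∀ t x, HasDerivAt (b t) (b₁ t x) x
  bound : ∀ t x, |b t x| ≤ B
  bound₁ : ∀ t x, |b₁ t x| ≤ B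

/-- `q` is the flow on `[0,τ]` of the velocity field `b`, and `J` is its space derivative. -/
structure IsFlow (τ : ℝ) (b b₁ q J : ℝ → ℝ → ℝ) : Prop where
  init : ∀ x, q 0 x = x
  init_J : ∀ x, J 0 x = 1
  cont : Continuous fun p : ℝ × ℝ => q p.1 p.2
  cont_J : Continuous fun p : ℝ × ℝ => J p.1 p.2
  pos_J : ∀ t x, 0 < J t x
  deriv_t : ∀ x, ∀ t ∈ Icc 0 τ, HasDerivWithinAt (fun r => q r x) (b t (q t x)) (Icc 0 τ) t
  deriv_J : ∀ x t, HasDerivAt (fun r => J r x) (b₁ t (q t x) * J t x) t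
  deriv_x : ∀ t ∈ Icc 0 τ, ∀ x, HasDerivAt (q t) (J t x) x
  bijective : ∀ t ∈ Icc 0 τ, Function.Bijective (q t)

variable {b b₁ : ℝ → ℝ → ℝ} {B : ℝ}

/-- The difference quotient of `b t` between `x` and `y`. -/
noncomputable def avgSlope (b₁ : ℝ → ℝ → ℝ) (t x y : ℝ) : ℝ :=
  ∫ θ in (0 : ℝ)..1, b₁ t (x + θ * (y - x))

theorem IsVelocity.sub_eq (hb : IsVelocity b b₁ B) (t x y : ℝ) :
    b t y - b t x = avgSlope b₁ t x y * (y - x) := by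
  have hd : ∀ θ ∈ uIcc (0 : ℝ) 1, HasDerivAt (fun θ => b t (x + θ * (y - x)))
      (b₁ t (x + θ * (y - x)) * (y - x)) θ := by
    intro θ _
    have h1 : HasDerivAt (fun θ => x + θ * (y - x)) (y - x) θ := by
      simpa using! ((hasDerivAt_id θ).mul_const (y - x)).const_add x
    exact (hb.deriv t _).comp θ h1
  have hc : Continuous fun θ => b₁ t (x + θ * (y - x)) :=
    hb.cont₁.comp (f := fun θ => (t, x + θ * (y - x))) (by fun_prop)
  have := intervalIntegral.integral_eq_sub_of_hasDerivAt hd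
    ((hc.mul continuous_const).intervalIntegrable _ _)
  rw [intervalIntegral.integral_mul_const] at this
  rw [avgSlope, this]
  ring_nf

theorem IsVelocity.continuous_avgSlope (hb : IsVelocity b b₁ B) {X : Type*} [TopologicalSpace X]
    {r x y : X → ℝ} (hr : Continuous r) (hx : Continuous x) (hy : Continuous y) :
    Continuous fun p => avgSlope b₁ (r p) (x p) (y p) := by
  unfold avgSlope
  refine intervalIntegral.continuous_parametric_intervalIntegral_of_continuous' ?_ _ _
  exact hb.cont₁.comp (f := fun p : X × ℝ => (r p.1, x p.1 + p.2 * (y p.1 - x p.1))) (by fun_prop)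

theorem IsVelocity.abs_avgSlope_le (hb : IsVelocity b b₁ B) (t x y : ℝ) :
    |avgSlope b₁ t x y| ≤ B := by
  have := intervalIntegral.norm_integral_le_of_norm_le_const (a := 0) (b := 1) (C := B)
    (f := fun θ => b₁ t (x + θ * (y - x))) fun θ _ => hb.bound₁ _ _
  simpa using! this

theorem IsVelocity.exists_trajectory (hb : IsVelocity b b₁ B) {τ t₀ : ℝ} (ht₀ : t₀ ∈ Icc 0 τ)
    (y : ℝ) : ∃ α : ℝ → ℝ, α t₀ = y ∧
      ∀ t ∈ Icc 0 τ, HasDerivWithinAt α (b t (α t)) (Icc 0 τ) t := by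
  have hB : 0 ≤ B := (abs_nonneg _).trans (hb.bound 0 0)
  -- A field bounded by `B` cannot leave the ball of radius `Bτ` in time `τ`, so a single
  -- application covers all of `[0,τ]`, from any starting time `t₀`.
  have hP : IsPicardLindelof b (⟨t₀, ht₀⟩ : Icc 0 τ) y (B.toNNReal * τ.toNNReal) 0 B.toNNReal
      B.toNNReal := by
    refine ⟨fun t _ => ?_, fun x _ => ?_, fun t _ x _ => ?_, ?_⟩
    · refine (LipschitzWith.of_dist_le_mul fun x y => ?_).lipschitzOnWith
      rw [Real.dist_eq, Real.dist_eq, hb.sub_eq, abs_mul, Real.coe_toNNReal _ hB]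
      gcongr
      exact hb.abs_avgSlope_le _ _ _
    · exact (hb.cont.comp (f := fun t : ℝ => (t, x)) (by fun_prop)).continuousOn
    · rw [Real.coe_toNNReal _ hB]
      exact hb.bound t x
    · simp only [NNReal.coe_zero, sub_zero, NNReal.coe_mul]
      gcongr
      rw [Real.coe_toNNReal _ (ht₀.1.trans ht₀.2)]
      exact max_le (by linarith [ht₀.1]) ht₀.2
  exact hP.exists_eq_forall_mem_Icc_hasDerivWithinAt₀

/-- Two trajectories, extended beyond `[0,τ]` in a continuous way, separate exponentially. -/
theorem IsVelocity.trajectory_sub (hb : IsVelocity b b₁ B) {τ : ℝ} {α β : ℝ → ℝ}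
    (hαc : Continuous α) (hβc : Continuous β)
    (hα : ∀ t ∈ Icc 0 τ, HasDerivWithinAt α (b t (α t)) (Icc 0 τ) t)
    (hβ : ∀ t ∈ Icc 0 τ, HasDerivWithinAt β (b t (β t)) (Icc 0 τ) t) {t : ℝ}
    (ht : t ∈ Icc 0 τ) :
    β t - α t = Real.exp (∫ r in (0 : ℝ)..t, avgSlope b₁ r (α r) (β r)) * (β 0 - α 0) := by
  have h := linear_ode_formula (y := fun r => β r - α r)
    (c := fun r => avgSlope b₁ r (α r) (β r)) (f := fun _ => 0)
    (hb.continuous_avgSlope continuous_id hαc hβc) continuous_const (fun r hr => ?_) le_rfl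
    ht.1 ht.2
  · simpa using h
  · rw [add_zero, ← hb.sub_eq]
    exact (hβ r hr).sub (hα r hr)

/-- Extension by constants of a function on `[0,τ]`. -/
noncomputable def clamp (τ t : ℝ) : ℝ := max 0 (min τ t)

theorem continuous_clamp (τ : ℝ) : Continuous (clamp τ) := by unfold clamp; fun_prop

theorem clamp_mem {τ : ℝ} (hτ : 0 ≤ τ) (t : ℝ) : clamp τ t ∈ Icc 0 τ :=
  ⟨le_max_left _ _, max_le hτ (min_le_left _ _)⟩

theorem clamp_of_mem {τ t : ℝ} (ht : t ∈ Icc 0 τ) : clamp τ t = t := by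
  unfold clamp
  rw [min_eq_right ht.2, max_eq_right ht.1]

theorem clamped_trajectory {τ : ℝ} {α : ℝ → ℝ} (hτ : 0 ≤ τ)
    (hα : ∀ t ∈ Icc 0 τ, HasDerivWithinAt α (b t (α t)) (Icc 0 τ) t) :
    Continuous (fun t => α (clamp τ t)) ∧ ∀ t ∈ Icc 0 τ,
      HasDerivWithinAt (fun t => α (clamp τ t)) (b t (α (clamp τ t))) (Icc 0 τ) t := by
  constructor
  · have h1 : ContinuousOn α (Icc 0 τ) := fun t ht => (hα t ht).continuousWithinAt
    exact h1.comp_continuous (continuous_clamp τ) (clamp_mem hτ)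
  · intro t ht
    rw [clamp_of_mem ht]
    exact (hα t ht).congr (fun r hr => by rw [clamp_of_mem hr]) (by rw [clamp_of_mem ht])

/-- The difference of two trajectories solves a linear equation whose coefficient is the mean of
`b₁` between them, so `q t y - q t x = exp(∫ avgSlope) (y - x)`. This gives the Lipschitz bound,
injectivity and, as `y → x`, the derivative `exp(∫ b₁)`. Surjectivity at time `t` comes from
trajectories started at `t` and followed back to `0`. -/
theorem IsVelocity.exists_flow (hb : IsVelocity b b₁ B) {τ : ℝ} (hτ : 0 ≤ τ) :
    ∃ q J, IsFlow τ b b₁ q J := by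
  have hB : 0 ≤ B := (abs_nonneg _).trans (hb.bound 0 0)
  have h0 : (0 : ℝ) ∈ Icc 0 τ := ⟨le_rfl, hτ⟩
  choose α hα0 hα using fun x => hb.exists_trajectory h0 x
  set q : ℝ → ℝ → ℝ := fun t x => α x (clamp τ t) with hq
  have hqc : ∀ x, Continuous fun t => q t x := fun x => (clamped_trajectory hτ (hα x)).1
  have hqd : ∀ x, ∀ t ∈ Icc 0 τ, HasDerivWithinAt (fun r => q r x) (b t (q t x)) (Icc 0 τ) t :=
    fun x => (clamped_trajectory hτ (hα x)).2
  have hq0 : ∀ x, q 0 x = x := fun x => by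
    simp only [hq]; rw [clamp_of_mem h0, hα0]
  have hsub : ∀ t ∈ Icc 0 τ, ∀ x y, q t y - q t x =
      Real.exp (∫ r in (0 : ℝ)..t, avgSlope b₁ r (q r x) (q r y)) * (y - x) := by
    intro t ht x y
    have := hb.trajectory_sub (hqc x) (hqc y) (hqd x) (hqd y) ht
    rwa [hq0, hq0] at this
  have hclamp : ∀ t x, q t x = q (clamp τ t) x := fun t x => by
    simp only [hq]; rw [clamp_of_mem (clamp_mem hτ t)]
  have hlipx : ∀ t x y, |q t y - q t x| ≤ Real.exp (B * τ) * |y - x| := by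
    intro t x y
    rw [hclamp t x, hclamp t y, hsub _ (clamp_mem hτ t), abs_mul, Real.abs_exp]
    gcongr
    have h1 : ‖∫ r in (0 : ℝ)..clamp τ t, avgSlope b₁ r (q r x) (q r y)‖
        ≤ B * |clamp τ t - 0| :=
      intervalIntegral.norm_integral_le_of_norm_le_const fun l _ => hb.abs_avgSlope_le _ _ _
    rw [sub_zero, abs_of_nonneg (clamp_mem hτ t).1] at h1
    refine (le_abs_self _).trans (h1.trans ?_)
    gcongr
    exact (clamp_mem hτ t).2
  have hlipt : ∀ t s x, |q t x - q s x| ≤ B * |clamp τ t - clamp τ s| := by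
    intro t s x
    rw [hclamp t x, hclamp s x]
    exact (convex_Icc 0 τ).norm_image_sub_le_of_norm_hasDerivWithin_le (hqd x)
      (fun r _ => hb.bound _ _) (clamp_mem hτ s) (clamp_mem hτ t)
  have hqcont : Continuous fun p : ℝ × ℝ => q p.1 p.2 := by
    refine continuous_iff_continuousAt.2 fun p => tendsto_iff_dist_tendsto_zero.2 ?_
    refine squeeze_zero (g := fun p' : ℝ × ℝ => Real.exp (B * τ) * |p'.2 - p.2| +
      B * |clamp τ p'.1 - clamp τ p.1|) (fun _ => dist_nonneg) (fun p' => ?_) ?_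
    · rw [Real.dist_eq]
      calc |q p'.1 p'.2 - q p.1 p.2|
          = |(q p'.1 p'.2 - q p'.1 p.2) + (q p'.1 p.2 - q p.1 p.2)| := by ring_nf
        _ ≤ _ := (abs_add_le _ _).trans (add_le_add (hlipx _ _ _) (hlipt _ _ _))
    · have hc : Continuous fun p' : ℝ × ℝ => Real.exp (B * τ) * |p'.2 - p.2| +
          B * |clamp τ p'.1 - clamp τ p.1| := by
        have := continuous_clamp τ
        fun_prop
      have := hc.tendsto p
      simpa using this
  have hb₁c : Continuous fun p : ℝ × ℝ => b₁ p.1 (q p.1 p.2) :=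
    hb.cont₁.comp (continuous_fst.prodMk hqcont)
  have hcx : ∀ x, Continuous fun r => b₁ r (q r x) := fun x =>
    hb₁c.comp (f := fun r : ℝ => (r, x)) (by fun_prop)
  refine ⟨q, fun t x => Real.exp (∫ r in (0 : ℝ)..t, b₁ r (q r x)),
    hq0, fun x => by simp, hqcont, ?_, fun _ _ => Real.exp_pos _, hqd, fun x t => ?_, ?_, ?_⟩
  · refine Real.continuous_exp.comp ?_
    refine intervalIntegral.continuous_parametric_intervalIntegral_of_continuous (μ := volume)
      (f := fun (p : ℝ × ℝ) r => b₁ r (q r p.2)) (s := fun p : ℝ × ℝ => p.1) (a₀ := 0) ?_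
      continuous_fst
    exact hb₁c.comp (f := fun p : (ℝ × ℝ) × ℝ => (p.2, p.1.2)) (by fun_prop)
  · have := (((hcx x).integral_hasStrictDerivAt 0 t).hasDerivAt).exp
    rwa [mul_comm] at this
  · intro t ht x
    set E : ℝ → ℝ := fun y => Real.exp (∫ r in (0 : ℝ)..t, avgSlope b₁ r (q r x) (q r y)) with hE
    have hEc : Continuous E := by
      refine Real.continuous_exp.comp ?_
      refine intervalIntegral.continuous_parametric_intervalIntegral_of_continuous' ?_ _ _
      exact hb.continuous_avgSlope (X := ℝ × ℝ) continuous_snd ((hqc x).comp continuous_snd)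
        (hqcont.comp (f := fun p : ℝ × ℝ => (p.2, p.1)) (by fun_prop))
    have hEx : E x = Real.exp (∫ r in (0 : ℝ)..t, b₁ r (q r x)) := by
      simp [hE, avgSlope]
    rw [← hEx, hasDerivAt_iff_tendsto_slope]
    refine ((hEc.tendsto x).mono_left nhdsWithin_le_nhds).congr' ?_
    filter_upwards [self_mem_nhdsWithin] with y hy
    have hyx : y - x ≠ 0 := sub_ne_zero.2 hy
    rw [slope_def_field, hsub t ht x y, mul_div_assoc, div_self hyx, mul_one]
  · intro t ht
    refine ⟨fun x y hxy => ?_, fun y => ?_⟩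
    · have := hsub t ht x y
      rw [hxy, sub_self, eq_comm, mul_eq_zero] at this
      rcases this with h | h
      · exact absurd h (Real.exp_ne_zero _)
      · linarith
    · obtain ⟨β, hβt, hβ⟩ := hb.exists_trajectory ht y
      obtain ⟨hβc, hβd⟩ := clamped_trajectory hτ hβ
      refine ⟨β 0, ?_⟩
      have := hb.trajectory_sub (hqc (β 0)) hβc (hqd (β 0)) hβd ht
      rw [clamp_of_mem ht, clamp_of_mem h0, hβt, hq0, sub_self, mul_zero] at this
      linarith

theorem IsFlow.lintegral_comp {τ : ℝ} {q J : ℝ → ℝ → ℝ} (h : IsFlow τ b b₁ q J) {t : ℝ}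
    (ht : t ∈ Icc 0 τ) (g : ℝ → ℝ≥0∞) :
    ∫⁻ x, g x = ∫⁻ x, ENNReal.ofReal (J t x) * g (q t x) := by
  have := lintegral_image_eq_lintegral_abs_deriv_mul MeasurableSet.univ
    (fun x _ => (h.deriv_x t ht x).hasDerivWithinAt) (h.bijective t ht).1.injOn g
  rw [image_univ_of_surjective (h.bijective t ht).2, Measure.restrict_univ] at this
  rw [this]
  simp only [abs_of_pos (h.pos_J t _)]

end Flow

end GengXue

namespace GengXue

/-! ### Evolution of value, slope and momentum along characteristics. -/

section Evolution

open Filter Topology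

theorem hasDerivAt_intervalIntegral_param {f f₁ : ℝ → ℝ → ℝ}
    (hf : Continuous fun p : ℝ × ℝ => f p.1 p.2) (hf₁ : Continuous fun p : ℝ × ℝ => f₁ p.1 p.2)
    {a b : ℝ} (hab : a ≤ b) (hd : ∀ r ∈ Icc a b, ∀ x, HasDerivAt (f r) (f₁ r x) x) (x : ℝ) :
    HasDerivAt (fun x => ∫ r in a..b, f r x) (∫ r in a..b, f₁ r x) x := by
  obtain ⟨C, hC⟩ := (isCompact_Icc (a := a) (b := b)).prod (isCompact_closedBall x 1)
    |>.exists_bound_of_continuousOn hf₁.continuousOn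
  have hfx : ∀ x, Continuous fun r => f r x := fun x =>
    hf.comp (f := fun r : ℝ => (r, x)) (by fun_prop)
  have hf₁x : Continuous fun r => f₁ r x := hf₁.comp (f := fun r : ℝ => (r, x)) (by fun_prop)
  refine (intervalIntegral.hasDerivAt_integral_of_dominated_loc_of_deriv_le
    (F := fun x r => f r x) (F' := fun x r => f₁ r x) (bound := fun _ => C)
    (Metric.closedBall_mem_nhds x one_pos)
    (Eventually.of_forall fun y => (hfx y).aestronglyMeasurable)
    ((hfx x).intervalIntegrable _ _) hf₁x.aestronglyMeasurable
    (ae_of_all _ fun r hr y hy => ?_) intervalIntegrable_const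
    (ae_of_all _ fun r hr y _ => ?_)).2
  · rw [uIoc_of_le hab] at hr
    exact hC (r, y) ⟨Ioc_subset_Icc_self hr, hy⟩
  · rw [uIoc_of_le hab] at hr
    exact hd r (Ioc_subset_Icc_self hr) y

/-- The time derivative of the space derivative is the space derivative of the time derivative. -/
theorem hasDerivWithinAt_swap {f f₁ g g₁ : ℝ → ℝ → ℝ} {τ : ℝ}
    (hg : Continuous fun p : ℝ × ℝ => g p.1 p.2) (hg₁ : Continuous fun p : ℝ × ℝ => g₁ p.1 p.2)
    (hf : ∀ x, ∀ t ∈ Icc 0 τ, HasDerivWithinAt (fun r => f r x) (g t x) (Icc 0 τ) t)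
    (hf₁ : ∀ t ∈ Icc 0 τ, ∀ x, HasDerivAt (f t) (f₁ t x) x)
    (hgd : ∀ t ∈ Icc 0 τ, ∀ x, HasDerivAt (g t) (g₁ t x) x) (x : ℝ) :
    ∀ t ∈ Icc 0 τ, HasDerivWithinAt (fun r => f₁ r x) (g₁ t x) (Icc 0 τ) t := by
  have hgx : ∀ x, Continuous fun r => g r x := fun x =>
    hg.comp (f := fun r : ℝ => (r, x)) (by fun_prop)
  have hg₁x : Continuous fun r => g₁ r x := hg₁.comp (f := fun r : ℝ => (r, x)) (by fun_prop)
  -- No mixed derivative of `f` is assumed. The equation is integrated in time, differentiated in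
  -- `x` under the integral, and then differentiated in time again.
  have key : ∀ t ∈ Icc 0 τ, f₁ t x = f₁ 0 x + ∫ r in (0 : ℝ)..t, g₁ r x := by
    intro t ht
    have h0 : (0 : ℝ) ∈ Icc 0 τ := ⟨le_rfl, ht.1.trans ht.2⟩
    have e : f t = fun y => f 0 y + ∫ r in (0 : ℝ)..t, g r y := by
      ext y
      rw [integral_eq_sub_of_hasDerivWithinAt_Icc (hf y) (hgx y).continuousOn le_rfl ht.1 ht.2]
      ring
    have h1 := hf₁ t ht x
    rw [e] at h1
    exact h1.unique ((hf₁ 0 h0 x).add (hasDerivAt_intervalIntegral_param hg hg₁ ht.1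
      (fun r hr => hgd r ⟨hr.1, hr.2.trans ht.2⟩) x))
  intro t ht
  have h2 := ((hg₁x.integral_hasStrictDerivAt 0 t).hasDerivAt.const_add
    (f₁ 0 x)).hasDerivWithinAt (s := Icc 0 τ)
  exact h2.congr (fun r hr => key r hr) (key t ht)

/-- The chain rule along a curve, for a function with continuous time derivative. -/
theorem hasDerivWithinAt_along {f g f₁ : ℝ → ℝ → ℝ} {q : ℝ → ℝ} {τ t b : ℝ}
    (hg : Continuous fun p : ℝ × ℝ => g p.1 p.2)
    (hf : ∀ x, ∀ t ∈ Icc 0 τ, HasDerivWithinAt (fun r => f r x) (g t x) (Icc 0 τ) t)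
    (ht : t ∈ Icc 0 τ) (hf₁ : HasDerivAt (f t) (f₁ t (q t)) (q t))
    (hq : HasDerivWithinAt q b (Icc 0 τ) t) :
    HasDerivWithinAt (fun r => f r (q r)) (g t (q t) + f₁ t (q t) * b) (Icc 0 τ) t := by
  have h1 : HasDerivWithinAt (fun r => f t (q r)) (f₁ t (q t) * b) (Icc 0 τ) t :=
    hf₁.comp_hasDerivWithinAt t hq
  -- At the frozen point `q r`, the mean value inequality in time compares this increment with `(r -
  -- t) g t (q t)`; joint continuity of `g` makes the error small.
  have h2 : HasDerivWithinAt (fun r => f r (q r) - f t (q r)) (g t (q t)) (Icc 0 τ) t := by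
    rw [hasDerivWithinAt_iff_isLittleO, Asymptotics.isLittleO_iff]
    intro ε hε
    have hev : ∀ᶠ p : ℝ × ℝ in 𝓝 t ×ˢ 𝓝 (q t), |g p.1 p.2 - g t (q t)| < ε := by
      rw [← nhds_prod_eq]
      exact Metric.tendsto_nhds.1 (hg.tendsto (t, q t)) ε hε
    obtain ⟨S, hS, R, hR, hSR⟩ := eventually_prod_iff.1 hev
    obtain ⟨δ, hδ, hδS⟩ := Metric.eventually_nhds_iff.1 hS
    have hRq : ∀ᶠ r in 𝓝[Icc 0 τ] t, R (q r) := hq.continuousWithinAt.eventually hR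
    filter_upwards [hRq, self_mem_nhdsWithin,
      mem_nhdsWithin_of_mem_nhds (Metric.ball_mem_nhds t hδ)] with r hr hrτ hrδ
    have hsub : uIcc t r ⊆ Icc 0 τ := uIcc_subset_Icc ht hrτ
    have := (convex_uIcc t r).norm_image_sub_le_of_norm_hasDerivWithin_le
      (f := fun σ => f σ (q r) - σ * g t (q t)) (f' := fun σ => g σ (q r) - g t (q t)) (C := ε)
      (fun σ hσ => ?_) (fun σ hσ => ?_) left_mem_uIcc right_mem_uIcc
    · convert this using 2
      simp only [smul_eq_mul]
      ring
    · refine ((hf (q r) σ (hsub hσ)).mono hsub).sub ?_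
      simpa using! ((hasDerivAt_id σ).mul_const (g t (q t))).hasDerivWithinAt
    · refine (hSR (hδS ?_) hr).le
      rw [Real.dist_eq]
      exact (abs_sub_left_of_mem_uIcc hσ).trans_lt hrδ
  convert! h2.add h1 using 1
  ext r
  simp

/-- A time-dependent function together with its first two space derivatives. -/
structure Jet where
  f0 : ℝ → ℝ → ℝ
  f1 : ℝ → ℝ → ℝ
  f2 : ℝ → ℝ → ℝ

/-- The regularity of `C([0,τ]; Hˢ)`, `s > 5/2`, that is used (the time being extended to `ℝ`). -/
structure Jet.IsRegular (U : Jet) (K : ℝ) : Prop where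
  deriv0 : ∀ t x, HasDerivAt (U.f0 t) (U.f1 t x) x
  deriv1 : ∀ t x, HasDerivAt (U.f1 t) (U.f2 t x) x
  cont0 : Continuous fun p : ℝ × ℝ => U.f0 p.1 p.2
  cont1 : Continuous fun p : ℝ × ℝ => U.f1 p.1 p.2
  cont2 : Continuous fun p : ℝ × ℝ => U.f2 p.1 p.2
  bound0 : ∀ t x, |U.f0 t x| ≤ K
  bound1 : ∀ t x, |U.f1 t x| ≤ K
  bound2 : ∀ t x, |U.f2 t x| ≤ K
  sq0 : ∀ t, eLpNorm (U.f0 t) 2 ≤ ENNReal.ofReal K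
  sq1 : ∀ t, eLpNorm (U.f1 t) 2 ≤ ENNReal.ofReal K
  lim : ∀ t, Tendsto (U.f0 t) (cocompact ℝ) (𝓝 0)

namespace Jet

variable (U V : Jet)

/-- The velocity `uv`. -/
def vel (t x : ℝ) : ℝ := U.f0 t x * V.f0 t x

/-- The space derivative of the velocity. -/
def vel₁ (t x : ℝ) : ℝ := U.f1 t x * V.f0 t x + U.f0 t x * V.f1 t x

/-- The source `3uvu_x - u v_xx u_x`. -/
def srcA (t x : ℝ) : ℝ := 3 * U.f0 t x * V.f0 t x * U.f1 t x - U.f0 t x * V.f2 t x * U.f1 t x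

/-- The source `2 u u_x v_x`. -/
def srcB (t x : ℝ) : ℝ := 2 * U.f0 t x * U.f1 t x * V.f1 t x

/-- The nonlocal term in the equation of `u`. -/
noncomputable def nonloc (t x : ℝ) : ℝ :=
  conv green (srcA U V t) x + conv greenD (srcB U V t) x

/-- The nonlocal term in the equation of `u_x`. -/
noncomputable def nonloc₁ (t x : ℝ) : ℝ :=
  conv greenD (srcA U V t) x + conv green (srcB U V t) x

/-- The derivative of the slope `u_x` along characteristics. -/
noncomputable def slopeRate (t x : ℝ) : ℝ :=
  -(V.f0 t x * U.f1 t x ^ 2) + U.f0 t x * V.f1 t x * U.f1 t x - nonloc₁ U V t x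

theorem vel_comm : vel U V = vel V U := by
  ext t x; simp only [vel]; ring

theorem vel₁_comm : vel₁ U V = vel₁ V U := by
  ext t x; simp only [vel₁]; ring

variable {U V} {K : ℝ}

theorem IsRegular.nonneg (hU : U.IsRegular K) : 0 ≤ K := (abs_nonneg _).trans (hU.bound0 0 0)

theorem continuous_srcA (hU : U.IsRegular K) (hV : V.IsRegular K) :
    Continuous fun p : ℝ × ℝ => srcA U V p.1 p.2 := by
  have := hU.cont0; have := hU.cont1; have := hV.cont0; have := hV.cont2
  unfold srcA; fun_prop

theorem continuous_srcB (hU : U.IsRegular K) (hV : V.IsRegular K) :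
    Continuous fun p : ℝ × ℝ => srcB U V p.1 p.2 := by
  have := hU.cont0; have := hU.cont1; have := hV.cont1
  unfold srcB; fun_prop

theorem abs_mul_mul_le {a b c A B C : ℝ} (ha : |a| ≤ A) (hb : |b| ≤ B) (hc : |c| ≤ C) :
    |a * b * c| ≤ A * B * C := by
  rw [abs_mul, abs_mul]
  have := (abs_nonneg a).trans ha
  have := (abs_nonneg b).trans hb
  gcongr

theorem abs_srcA_le (hU : U.IsRegular K) (hV : V.IsRegular K) (t x : ℝ) :
    |srcA U V t x| ≤ 4 * K ^ 3 := by
  have h1 := abs_mul_mul_le (hU.bound0 t x) (hV.bound0 t x) (hU.bound1 t x)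
  have h2 := abs_mul_mul_le (hU.bound0 t x) (hV.bound2 t x) (hU.bound1 t x)
  unfold srcA
  rw [abs_le] at *
  constructor <;> nlinarith

theorem abs_srcB_le (hU : U.IsRegular K) (hV : V.IsRegular K) (t x : ℝ) :
    |srcB U V t x| ≤ 4 * K ^ 3 := by
  have h1 := abs_mul_mul_le (hU.bound0 t x) (hU.bound1 t x) (hV.bound1 t x)
  have hK : 0 ≤ K ^ 3 := pow_nonneg hU.nonneg 3
  unfold srcB
  rw [abs_le] at *
  constructor <;> nlinarith

theorem continuous_slice {f : ℝ → ℝ → ℝ} (hf : Continuous fun p : ℝ × ℝ => f p.1 p.2) (t : ℝ) :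
    Continuous (f t) :=
  hf.comp (f := fun x : ℝ => (t, x)) (by fun_prop)

theorem continuous_nonloc (hU : U.IsRegular K) (hV : V.IsRegular K) :
    Continuous fun p : ℝ × ℝ => nonloc U V p.1 p.2 :=
  (isKernel_green.continuous_conv (continuous_srcA hU hV) (abs_srcA_le hU hV)).add
    (isKernel_greenD.continuous_conv (continuous_srcB hU hV) (abs_srcB_le hU hV))

theorem continuous_nonloc₁ (hU : U.IsRegular K) (hV : V.IsRegular K) :
    Continuous fun p : ℝ × ℝ => nonloc₁ U V p.1 p.2 :=
  (isKernel_greenD.continuous_conv (continuous_srcA hU hV) (abs_srcA_le hU hV)).add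
    (isKernel_green.continuous_conv (continuous_srcB hU hV) (abs_srcB_le hU hV))

theorem hasDerivAt_nonloc (hU : U.IsRegular K) (hV : V.IsRegular K) (t x : ℝ) :
    HasDerivAt (nonloc U V t) (nonloc₁ U V t x - srcB U V t x) x := by
  convert! (hasDerivAt_conv_green (continuous_slice (continuous_srcA hU hV) t)
    (abs_srcA_le hU hV t) x).add (hasDerivAt_conv_greenD
    (continuous_slice (continuous_srcB hU hV) t) (abs_srcB_le hU hV t) x) using 1
  unfold nonloc₁; ring

theorem hasDerivAt_nonloc₁ (hU : U.IsRegular K) (hV : V.IsRegular K) (t x : ℝ) :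
    HasDerivAt (nonloc₁ U V t) (nonloc U V t x - srcA U V t x) x := by
  convert! (hasDerivAt_conv_greenD (continuous_slice (continuous_srcA hU hV) t)
    (abs_srcA_le hU hV t) x).add (hasDerivAt_conv_green
    (continuous_slice (continuous_srcB hU hV) t) (abs_srcB_le hU hV t) x) using 1
  unfold nonloc; ring

theorem isVelocity (hU : U.IsRegular K) (hV : V.IsRegular K) :
    IsVelocity (vel U V) (vel₁ U V) (2 * K ^ 2) := by
  have := hU.cont0; have := hU.cont1; have := hV.cont0; have := hV.cont1
  have hK := hU.nonneg
  have hm : ∀ {a b : ℝ}, |a| ≤ K → |b| ≤ K → |a * b| ≤ K ^ 2 := by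
    intro a b ha hb
    rw [abs_mul, sq]
    gcongr
  refine ⟨by unfold vel; fun_prop, by unfold vel₁; fun_prop,
    fun t x => (hU.deriv0 t x).mul (hV.deriv0 t x), fun t x => ?_, fun t x => ?_⟩
  · refine (hm (hU.bound0 t x) (hV.bound0 t x)).trans ?_
    nlinarith [sq_nonneg K]
  · refine (abs_add_le _ _).trans ?_
    linarith [hm (hU.bound1 t x) (hV.bound0 t x), hm (hU.bound0 t x) (hV.bound1 t x)]

/-- `u` solves the first equation of the system on `[0,τ]`. -/
def Solves (U V : Jet) (τ : ℝ) : Prop :=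
  ∀ x, ∀ t ∈ Icc 0 τ, HasDerivWithinAt (fun r => U.f0 r x)
    (-(U.f0 t x * V.f0 t x * U.f1 t x + nonloc U V t x)) (Icc 0 τ) t

variable {τ : ℝ} {q J : ℝ → ℝ → ℝ}

theorem value_along (hU : U.IsRegular K) (hV : V.IsRegular K) (h : Solves U V τ)
    (hq : IsFlow τ (vel U V) (vel₁ U V) q J) (x : ℝ) {t : ℝ} (ht : t ∈ Icc 0 τ) :
    HasDerivWithinAt (fun r => U.f0 r (q r x)) (-nonloc U V t (q t x)) (Icc 0 τ) t := by
  have hc : Continuous fun p : ℝ × ℝ => -(U.f0 p.1 p.2 * V.f0 p.1 p.2 * U.f1 p.1 p.2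
      + nonloc U V p.1 p.2) := by
    have := hU.cont0; have := hU.cont1; have := hV.cont0; have := continuous_nonloc hU hV
    fun_prop
  have := hasDerivWithinAt_along (f₁ := U.f1)
    (g := fun t x => -(U.f0 t x * V.f0 t x * U.f1 t x + nonloc U V t x)) hc h ht
    (hU.deriv0 t _) (hq.deriv_t x t ht)
  convert! this using 1
  simp only [vel]; ring

/-- Differentiating the nonlocal term releases `-srcB = -2 u u_x v_x`; with its sign in the equation
this turns `-(uv)_x u_x` into `-v u_x² + u v_x u_x`, and the transport term cancels `uv u_xx`. -/
theorem slope_along (hU : U.IsRegular K) (hV : V.IsRegular K) (h : Solves U V τ)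
    (hq : IsFlow τ (vel U V) (vel₁ U V) q J) (x : ℝ) {t : ℝ} (ht : t ∈ Icc 0 τ) :
    HasDerivWithinAt (fun r => U.f1 r (q r x)) (slopeRate U V t (q t x)) (Icc 0 τ) t := by
  have hc : Continuous fun p : ℝ × ℝ => -(U.f0 p.1 p.2 * V.f0 p.1 p.2 * U.f1 p.1 p.2
      + nonloc U V p.1 p.2) := by
    have := hU.cont0; have := hU.cont1; have := hV.cont0; have := continuous_nonloc hU hV
    fun_prop
  have hc₁ : Continuous fun p : ℝ × ℝ => -(vel₁ U V p.1 p.2 * U.f1 p.1 p.2 +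
      vel U V p.1 p.2 * U.f2 p.1 p.2 + (nonloc₁ U V p.1 p.2 - srcB U V p.1 p.2)) := by
    have := hU.cont1; have := hU.cont2; have := (isVelocity hU hV).cont
    have := (isVelocity hU hV).cont₁
    have := continuous_nonloc₁ hU hV; have := continuous_srcB hU hV
    fun_prop
  have h1 := fun x => hasDerivWithinAt_swap (f := U.f0) (f₁ := U.f1)
    (g := fun t x => -(U.f0 t x * V.f0 t x * U.f1 t x + nonloc U V t x))
    (g₁ := fun t x => -(vel₁ U V t x * U.f1 t x + vel U V t x * U.f2 t x
      + (nonloc₁ U V t x - srcB U V t x))) hc hc₁ h (fun t _ => hU.deriv0 t)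
    (fun t _ x => ((((isVelocity hU hV).deriv t x).mul (hU.deriv1 t x)).add
      (hasDerivAt_nonloc hU hV t x)).neg) x
  have := hasDerivWithinAt_along (f₁ := U.f2)
    (g := fun t x => -(vel₁ U V t x * U.f1 t x + vel U V t x * U.f2 t x
      + (nonloc₁ U V t x - srcB U V t x))) hc₁ h1 ht (hU.deriv1 t _) (hq.deriv_t x t ht)
  convert! this using 1
  simp only [vel, vel₁, slopeRate, srcB]; ring

/-- The quadratic term `-v u_x²` is cancelled by the part `v u_x` of `J'/J`. What remains is linear,
which is why the total variation of `u` can be bounded while `u_x` itself blows up. -/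
theorem weighted_slope_along (hU : U.IsRegular K) (hV : V.IsRegular K) (h : Solves U V τ)
    (hq : IsFlow τ (vel U V) (vel₁ U V) q J) (x : ℝ) {t : ℝ} (ht : t ∈ Icc 0 τ) :
    HasDerivWithinAt (fun r => U.f1 r (q r x) * J r x)
      (2 * (U.f0 t (q t x) * V.f1 t (q t x)) * (U.f1 t (q t x) * J t x)
        + -(nonloc₁ U V t (q t x) * J t x)) (Icc 0 τ) t := by
  convert! (slope_along hU hV h hq x ht).mul (hq.deriv_J x t).hasDerivWithinAt using 1
  simp only [vel₁, slopeRate]; ring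

/-- An equation for `u_xx` at a fixed point would involve `u_xxx`, which need not exist. In
Lagrangian variables the transport term is absent: `slopeRate` contains no second derivatives
outside the convolutions, so the equation of `u_x ∘ q` may be differentiated in the label `x`, and
division by `J` recovers `u_xx ∘ q`. -/
theorem momentum_along (hU : U.IsRegular K) (hV : V.IsRegular K) (h : Solves U V τ)
    (hq : IsFlow τ (vel U V) (vel₁ U V) q J) (x : ℝ) {t : ℝ} (ht : t ∈ Icc 0 τ) :
    HasDerivWithinAt (fun r => U.f0 r (q r x) - U.f2 r (q r x))
      (-3 * (V.f0 t (q t x) * U.f1 t (q t x)) * (U.f0 t (q t x) - U.f2 t (q t x)))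
      (Icc 0 τ) t := by
  set g₁ : ℝ → ℝ → ℝ := fun t x => -2 * V.f0 t x * U.f1 t x * U.f2 t x
    + U.f0 t x * V.f1 t x * U.f2 t x + 3 * U.f0 t x * V.f0 t x * U.f1 t x - nonloc U V t x with hg₁
  have hqp : Continuous fun p : ℝ × ℝ => (p.1, q p.1 p.2) := continuous_fst.prodMk hq.cont
  have hc : Continuous fun p : ℝ × ℝ => slopeRate U V p.1 p.2 := by
    have := hU.cont0; have := hU.cont1; have := hV.cont0; have := hV.cont1
    have := continuous_nonloc₁ hU hV
    unfold slopeRate; fun_prop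
  have hc₁ : Continuous fun p : ℝ × ℝ => g₁ p.1 p.2 := by
    have := hU.cont0; have := hU.cont1; have := hU.cont2; have := hV.cont0; have := hV.cont1
    have := continuous_nonloc hU hV
    simp only [hg₁]; fun_prop
  have hd : ∀ t x, HasDerivAt (slopeRate U V t) (g₁ t x) x := by
    intro t x
    convert! (((hV.deriv0 t x).mul ((hU.deriv1 t x).pow 2)).neg.add
      (((hU.deriv0 t x).mul (hV.deriv1 t x)).mul (hU.deriv1 t x))).sub
      (hasDerivAt_nonloc₁ hU hV t x) using 1
    simp only [hg₁, srcA, Pi.mul_apply, Pi.pow_apply]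
    push_cast
    ring
  have h1 := hasDerivWithinAt_swap (f := fun t x => U.f1 t (q t x))
    (f₁ := fun t x => U.f2 t (q t x) * J t x) (g := fun t x => slopeRate U V t (q t x))
    (g₁ := fun t x => g₁ t (q t x) * J t x) (τ := τ) (hc.comp hqp)
    ((hc₁.comp hqp).mul hq.cont_J)
    (fun x t ht => slope_along hU hV h hq x ht)
    (fun t ht x => (hU.deriv1 t _).comp x (hq.deriv_x t ht x))
    (fun t ht x => (hd t _).comp x (hq.deriv_x t ht x)) x t ht
  have h2 := h1.div (hq.deriv_J x t).hasDerivWithinAt (hq.pos_J t x).ne'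
  have hJ := (hq.pos_J t x).ne'
  convert! (value_along hU hV h hq x ht).sub h2 using 1
  · ext r
    simp only [Pi.sub_apply, Pi.div_apply]
    rw [mul_div_cancel_right₀ _ (hq.pos_J r x).ne']
  · simp only [hg₁, vel₁]
    field_simp
    ring

end Jet

end Evolution

end GengXue

namespace GengXue

/-! ### A priori bounds for the total variation of `u` and the momentum of `v`. -/

section Estimates

open Filter Topology

theorem IsKernel.conv_sub {k : ℝ → ℝ} (hk : IsKernel k) {f g : ℝ → ℝ} (hf : Continuous f)
    (hg : Continuous g) {C D : ℝ} (hC : ∀ x, |f x| ≤ C) (hD : ∀ x, |g x| ≤ D) (x : ℝ) :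
    conv k (fun y => f y - g y) x = conv k f x - conv k g x := by
  unfold conv
  rw [← integral_sub (hk.integrable hf hC x) (hk.integrable hg hD x)]
  simp only [mul_sub]

/-- A function that vanishes at infinity is bounded by half of the total mass of its derivative. -/
theorem abs_le_half_of_lintegral_deriv {f f' : ℝ → ℝ} (hf : ∀ x, HasDerivAt f (f' x) x)
    (hf' : Continuous f') (hlim : Tendsto f (cocompact ℝ) (𝓝 0)) {A : ℝ} (hA : 0 ≤ A)
    (h : ∫⁻ x, ENNReal.ofReal |f' x| ≤ ENNReal.ofReal A) (x : ℝ) : |f x| ≤ A / 2 := by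
  have hint : Integrable f' := by
    refine ⟨hf'.aestronglyMeasurable, ?_⟩
    simp only [HasFiniteIntegral, ← ofReal_norm, Real.norm_eq_abs]
    exact h.trans_lt ENNReal.ofReal_lt_top
  rw [cocompact_eq_atBot_atTop, tendsto_sup] at hlim
  have h1 := integral_Iic_of_hasDerivAt_of_tendsto' (a := x) (fun y _ => hf y) hint.integrableOn
    hlim.1
  have h2 := integral_Ioi_of_hasDerivAt_of_tendsto' (a := x) (fun y _ => hf y) hint.integrableOn
    hlim.2
  have h3 : ∫ y, |f' y| ≤ A := by
    rw [integral_eq_lintegral_of_nonneg_ae (ae_of_all _ fun y => abs_nonneg _)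
      hf'.abs.aestronglyMeasurable]
    exact ENNReal.toReal_le_of_le_ofReal hA h
  have h4 : (∫ y in Iic x, |f' y|) + ∫ y in Ioi x, |f' y| = ∫ y, |f' y| := by
    rw [← compl_Iic]
    exact integral_add_compl measurableSet_Iic hint.abs
  have h5 : |f x| ≤ ∫ y in Iic x, |f' y| := by
    have := abs_integral_le_integral_abs (f := f') (μ := volume.restrict (Iic x))
    rwa [h1, sub_zero] at this
  have h6 : |f x| ≤ ∫ y in Ioi x, |f' y| := by
    have := abs_integral_le_integral_abs (f := f') (μ := volume.restrict (Ioi x))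
    rwa [h2, zero_sub, abs_neg] at this
  linarith

namespace Jet

variable {U V : Jet} {K : ℝ}

/-- `V.f0 - V.f2` is the momentum density; its supremum controls the first two derivatives. -/
theorem IsRegular.abs_le_momentum (hV : V.IsRegular K) {N t : ℝ}
    (hN : ∀ x, |V.f0 t x - V.f2 t x| ≤ N) (x : ℝ) :
    |V.f0 t x| ≤ N ∧ |V.f1 t x| ≤ N ∧ |V.f2 t x| ≤ 2 * N := by
  have c0 := continuous_slice hV.cont0 t
  have c1 := continuous_slice hV.cont1 t
  have c2 := continuous_slice hV.cont2 t
  -- Convolution with `p` inverts `1 - ∂ₓ²`, so `v = p * n` and `v_x = p' * n`; the bound of `v_xx =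
  -- v - n` costs a factor `2`.
  have e0 : V.f0 t x = conv green (fun y => V.f0 t y - V.f2 t y) x := by
    rw [isKernel_green.conv_sub c0 c2 (hV.bound0 t) (hV.bound2 t),
      conv_green_deriv (hV.deriv1 t) (hV.bound1 t) c2 (hV.bound2 t),
      conv_greenD_deriv (hV.deriv0 t) (hV.bound0 t) c1 (hV.bound1 t)]
    ring
  have e1 : V.f1 t x = conv greenD (fun y => V.f0 t y - V.f2 t y) x := by
    rw [isKernel_greenD.conv_sub c0 c2 (hV.bound0 t) (hV.bound2 t),
      conv_greenD_deriv (hV.deriv1 t) (hV.bound1 t) c2 (hV.bound2 t),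
      conv_green_deriv (hV.deriv0 t) (hV.bound0 t) c1 (hV.bound1 t)]
    ring
  have h0 : |V.f0 t x| ≤ N := e0 ▸ isKernel_green.abs_conv_le hN x
  refine ⟨h0, e1 ▸ isKernel_greenD.abs_conv_le hN x, ?_⟩
  have := hN x
  rw [abs_le] at *
  constructor <;> linarith

/-- Bounds of the total variation of `u` and of the momentum density of `v` at time `t`. -/
def Controlled (U V : Jet) (K t : ℝ) : Prop :=
  ∫⁻ x, ENNReal.ofReal |U.f1 t x| ≤ ENNReal.ofReal K ∧ ∀ x, |V.f0 t x - V.f2 t x| ≤ K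

theorem Controlled.mono {A B t : ℝ} (h : Controlled U V A t) (hAB : A ≤ B) :
    Controlled U V B t :=
  ⟨h.1.trans (ENNReal.ofReal_le_ofReal hAB), fun x => (h.2 x).trans hAB⟩

theorem Controlled.nonneg {A t : ℝ} (h : Controlled U V A t) : 0 ≤ A :=
  (abs_nonneg _).trans (h.2 0)

section

variable {A t : ℝ}

theorem Controlled.abs_f0_le (h : Controlled U V A t) (hU : U.IsRegular K) (x : ℝ) :
    |U.f0 t x| ≤ A / 2 :=
  abs_le_half_of_lintegral_deriv (hU.deriv0 t) (continuous_slice hU.cont1 t) (hU.lim t) h.nonneg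
    h.1 x

theorem Controlled.abs_srcA_le (h : Controlled U V A t) (hU : U.IsRegular K)
    (hV : V.IsRegular K) (x : ℝ) : |srcA U V t x| ≤ 5 / 2 * A ^ 2 * |U.f1 t x| := by
  obtain ⟨h0, h1, h2⟩ := hV.abs_le_momentum h.2 x
  have hu := h.abs_f0_le hU x
  have hA := h.nonneg
  have e : srcA U V t x = U.f0 t x * (3 * V.f0 t x - V.f2 t x) * U.f1 t x := by
    unfold srcA; ring
  have h3 : |3 * V.f0 t x - V.f2 t x| ≤ 5 * A := by
    rw [abs_le] at *
    constructor <;> linarith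
  rw [e]
  refine (abs_mul_mul_le hu h3 le_rfl).trans (le_of_eq ?_)
  ring

theorem Controlled.abs_srcB_le (h : Controlled U V A t) (hU : U.IsRegular K)
    (hV : V.IsRegular K) (x : ℝ) : |srcB U V t x| ≤ A ^ 2 * |U.f1 t x| := by
  obtain ⟨h0, h1, h2⟩ := hV.abs_le_momentum h.2 x
  have hu := h.abs_f0_le hU x
  have e : srcB U V t x = 2 * (U.f0 t x * V.f1 t x * U.f1 t x) := by
    unfold srcB; ring
  have := abs_mul_mul_le hu h1 (le_refl |U.f1 t x|)
  rw [e, abs_mul, abs_two]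
  linarith

theorem Controlled.abs_nonloc₁_le (h : Controlled U V A t) (hU : U.IsRegular K)
    (hV : V.IsRegular K) (x : ℝ) : |nonloc₁ U V t x| ≤ 7 / 4 * A ^ 3 := by
  have hA := h.nonneg
  have h1 := isKernel_greenD.abs_conv_le_of_lintegral (by positivity) hA
    (h.abs_srcA_le hU hV) h.1 x
  have h2 := isKernel_green.abs_conv_le_of_lintegral (by positivity) hA
    (h.abs_srcB_le hU hV) h.1 x
  unfold nonloc₁
  refine (abs_add_le _ _).trans ((add_le_add h1 h2).trans (le_of_eq ?_))
  ring

theorem lintegral_abs_nonloc₁_le (hU : U.IsRegular K) (hV : V.IsRegular K) {g : ℝ → ℝ}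
    {c d : ℝ} (hA : 0 ≤ A) (hg : Continuous g) (hc : 0 ≤ c) (hd : 0 ≤ d)
    (h1 : ∀ x, |srcA U V t x| ≤ c * |g x|) (h2 : ∀ x, |srcB U V t x| ≤ d * |g x|)
    (h : ∫⁻ x, ENNReal.ofReal |g x| ≤ ENNReal.ofReal A) :
    ∫⁻ x, ENNReal.ofReal |nonloc₁ U V t x| ≤ ENNReal.ofReal ((c + d) * A) := by
  have i1 := isKernel_greenD.lintegral_conv_le hc hg h1 h
  have i2 := isKernel_green.lintegral_conv_le hd hg h2 h
  have hm := continuous_slice (f := fun t => conv greenD (srcA U V t)) (isKernel_greenD.continuous_conv (continuous_srcA hU hV)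
    (Jet.abs_srcA_le hU hV)) t
  calc ∫⁻ x, ENNReal.ofReal |nonloc₁ U V t x|
      ≤ ∫⁻ x, ENNReal.ofReal |conv greenD (srcA U V t) x|
          + ENNReal.ofReal |conv green (srcB U V t) x| := by
        refine lintegral_mono fun x => ?_
        rw [← ENNReal.ofReal_add (abs_nonneg _) (abs_nonneg _)]
        exact ENNReal.ofReal_le_ofReal (abs_add_le _ _)
    _ = _ := lintegral_add_left (by fun_prop) _
    _ ≤ ENNReal.ofReal (c * A) + ENNReal.ofReal (d * A) := add_le_add i1 i2
    _ = _ := by rw [← ENNReal.ofReal_add (by positivity) (by positivity)]; ring_nf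

theorem Controlled.lintegral_abs_nonloc₁_le (h : Controlled U V A t) (hU : U.IsRegular K)
    (hV : V.IsRegular K) :
    ∫⁻ x, ENNReal.ofReal |nonloc₁ U V t x| ≤ ENNReal.ofReal (7 / 2 * A ^ 3) := by
  refine (Jet.lintegral_abs_nonloc₁_le hU hV h.nonneg (continuous_slice hU.cont1 t)
    (by positivity) (by positivity) (h.abs_srcA_le hU hV) (h.abs_srcB_le hU hV) h.1).trans
    (le_of_eq ?_)
  ring_nf

/-- The nonlocal term is integrable at any time, as a consequence of the `L²` bounds. -/
theorem IsRegular.lintegral_abs_nonloc₁_le (hU : U.IsRegular K) (hV : V.IsRegular K) (t : ℝ) :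
    ∫⁻ x, ENNReal.ofReal |nonloc₁ U V t x| ≤ ENNReal.ofReal (6 * K ^ 3) := by
  have hK := hU.nonneg
  have c0 := continuous_slice hU.cont0 t
  have c1 := continuous_slice hU.cont1 t
  have hg : ∫⁻ x, ENNReal.ofReal |U.f0 t x * U.f1 t x| ≤ ENNReal.ofReal (K ^ 2) := by
    have h1 := eLpNorm_smul_le_mul_eLpNorm (p := 2) (q := 2) (r := 1) (μ := volume)
      c1.aestronglyMeasurable c0.aestronglyMeasurable
    rw [eLpNorm_one_eq_lintegral_enorm] at h1
    calc ∫⁻ x, ENNReal.ofReal |U.f0 t x * U.f1 t x|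
        = ∫⁻ x, ‖(U.f0 t • U.f1 t) x‖ₑ := by
          refine lintegral_congr fun x => ?_
          rw [← ofReal_norm]; rfl
      _ ≤ ENNReal.ofReal K * ENNReal.ofReal K := h1.trans (mul_le_mul' (hU.sq0 t) (hU.sq1 t))
      _ = _ := by rw [← ENNReal.ofReal_mul hK, sq]
  refine (Jet.lintegral_abs_nonloc₁_le (g := fun x => U.f0 t x * U.f1 t x) (c := 4 * K)
    (d := 2 * K) hU hV (by positivity) (by fun_prop) (by positivity) (by positivity) (fun x => ?_)
    (fun x => ?_) hg).trans (le_of_eq (by ring_nf))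
  · have e : srcA U V t x = (3 * V.f0 t x - V.f2 t x) * (U.f0 t x * U.f1 t x) := by
      unfold srcA; ring
    rw [e, abs_mul]
    gcongr
    have h1 := hV.bound0 t x
    have h2 := hV.bound2 t x
    rw [abs_le] at *
    constructor <;> linarith
  · have e : srcB U V t x = (2 * V.f1 t x) * (U.f0 t x * U.f1 t x) := by
      unfold srcB; ring
    rw [e, abs_mul]
    gcongr
    rw [abs_mul, abs_two]
    linarith [hV.bound1 t x]

/-- The nonlocal term in the equation of `v` does not feel the second derivative of `u`. -/
theorem Controlled.abs_nonloc_le (h : Controlled U V A t) (hU : U.IsRegular K)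
    (hV : V.IsRegular K) (x : ℝ) : |nonloc V U t x| ≤ 7 / 2 * A ^ 3 := by
  have hA := h.nonneg
  have u0 := continuous_slice hU.cont0 t
  have u1 := continuous_slice hU.cont1 t
  have u2 := continuous_slice hU.cont2 t
  have v0 := continuous_slice hV.cont0 t
  have v1 := continuous_slice hV.cont1 t
  have v2 := continuous_slice hV.cont2 t
  have hK := hU.nonneg
  -- The term `v v_x u_xx` equals `g' - (v_x² + v v_xx) u_x`, and `p * g' = p' * g` removes `u_xx`.
  -- Since `srcB V U = 2g`, one copy of `p' * g` survives. The three pieces contribute `3/2 + 3/2 +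
  -- 1/2 = 7/2`.
  set g : ℝ → ℝ := fun y => V.f0 t y * V.f1 t y * U.f1 t y with hg
  set g' : ℝ → ℝ := fun y => V.f1 t y * V.f1 t y * U.f1 t y + V.f0 t y * V.f2 t y * U.f1 t y
    + V.f0 t y * V.f1 t y * U.f2 t y with hg'
  set a : ℝ → ℝ := fun y => 3 * (V.f0 t y * V.f1 t y * U.f0 t y) with ha
  set b : ℝ → ℝ := fun y => (V.f1 t y * V.f1 t y + V.f0 t y * V.f2 t y) * U.f1 t y with hb
  have hgb : ∀ y, |g y| ≤ K * K * K := fun y =>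
    abs_mul_mul_le (hV.bound0 t y) (hV.bound1 t y) (hU.bound1 t y)
  have hg'b : ∀ y, |g' y| ≤ K * K * K + K * K * K + K * K * K := fun y =>
    (abs_add_three _ _ _).trans (add_le_add (add_le_add
      (abs_mul_mul_le (hV.bound1 t y) (hV.bound1 t y) (hU.bound1 t y))
      (abs_mul_mul_le (hV.bound0 t y) (hV.bound2 t y) (hU.bound1 t y)))
      (abs_mul_mul_le (hV.bound0 t y) (hV.bound1 t y) (hU.bound2 t y)))
  have hgd : ∀ y, HasDerivAt g (g' y) y := by
    intro y
    convert! ((hV.deriv0 t y).mul (hV.deriv1 t y)).mul (hU.deriv1 t y) using 1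
    simp only [hg', Pi.mul_apply]; ring
  have hgc : Continuous g := by fun_prop
  have hg'c : Continuous g' := by fun_prop
  have hac : Continuous a := by fun_prop
  have hbc : Continuous b := by fun_prop
  have haA : ∀ y, |a y| ≤ 3 / 2 * A ^ 3 := by
    intro y
    obtain ⟨h0, h1, h2⟩ := hV.abs_le_momentum h.2 y
    have := abs_mul_mul_le h0 h1 (h.abs_f0_le hU y)
    simp only [ha]
    rw [abs_mul, abs_of_pos (by norm_num : (0 : ℝ) < 3)]
    linarith
  have hbA : ∀ y, |b y| ≤ 3 * A ^ 2 * |U.f1 t y| := by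
    intro y
    obtain ⟨h0, h1, h2⟩ := hV.abs_le_momentum h.2 y
    simp only [hb, abs_mul _ (U.f1 t y)]
    gcongr
    refine (abs_add_le _ _).trans ?_
    rw [abs_mul, abs_mul]
    have e1 : |V.f1 t y| * |V.f1 t y| ≤ A * A := by gcongr
    have e2 : |V.f0 t y| * |V.f2 t y| ≤ A * (2 * A) := by gcongr
    linarith
  have hbK : ∀ y, |b y| ≤ 3 * A ^ 2 * K := fun y =>
    (hbA y).trans (by gcongr; exact hU.bound1 t y)
  have hgA : ∀ y, |g y| ≤ A ^ 2 * |U.f1 t y| := by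
    intro y
    obtain ⟨h0, h1, h2⟩ := hV.abs_le_momentum h.2 y
    refine (abs_mul_mul_le h0 h1 le_rfl).trans (le_of_eq (by ring))
  have eA : srcA V U t = fun y => (a y + b y) - g' y := by
    ext y; simp only [srcA, ha, hb, hg']; ring
  have eB : srcB V U t = fun y => g y + g y := by
    ext y; simp only [srcB, hg]; ring
  have e : nonloc V U t x = conv green a x + conv green b x + conv greenD g x := by
    unfold nonloc
    rw [eA, eB, isKernel_greenD.conv_add hgc hgc hgb hgb,
      isKernel_green.conv_sub (by fun_prop) hg'c
        (fun y => (abs_add_le _ _).trans (add_le_add (haA y) (hbK y))) hg'b,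
      isKernel_green.conv_add hac hbc haA hbK, conv_green_deriv hgd hgb hg'c hg'b]
    ring
  rw [e]
  refine (abs_add_three _ _ _).trans ?_
  have i1 := isKernel_green.abs_conv_le haA x
  have i2 := isKernel_green.abs_conv_le_of_lintegral (by positivity) hA hbA h.1 x
  have i3 := isKernel_greenD.abs_conv_le_of_lintegral (by positivity) hA hgA h.1 x
  linarith

end

variable {τ : ℝ} {q J : ℝ → ℝ → ℝ}

/-- Growth of the total variation of `u`. -/
theorem lintegral_slope_le (hU : U.IsRegular K) (hV : V.IsRegular K) (h : Solves U V τ)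
    (hq : IsFlow τ (vel U V) (vel₁ U V) q J) {s t A C D : ℝ} (hs : 0 ≤ s) (hst : s ≤ t)
    (ht : t ≤ τ) (hA : 0 ≤ A) (hD : 0 ≤ D)
    (hC : ∀ r ∈ Icc s t, ∀ x, 2 * |U.f0 r x * V.f1 r x| ≤ C)
    (hDr : ∀ r ∈ Icc s t, ∫⁻ x, ENNReal.ofReal |nonloc₁ U V r x| ≤ ENNReal.ofReal D)
    (hAs : ∫⁻ x, ENNReal.ofReal |U.f1 s x| ≤ ENNReal.ofReal A) :
    ∫⁻ x, ENNReal.ofReal |U.f1 t x|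
      ≤ ENNReal.ofReal (Real.exp (C * (t - s)) * (A + D * (t - s))) := by
  have hqp : Continuous fun p : ℝ × ℝ => (p.1, q p.1 p.2) := continuous_fst.prodMk hq.cont
  have hcontf : Continuous fun p : ℝ × ℝ => nonloc₁ U V p.1 (q p.1 p.2) * J p.1 p.2 :=
    ((continuous_nonloc₁ hU hV).comp hqp).mul hq.cont_J
  have hcontc : Continuous fun p : ℝ × ℝ =>
      2 * (U.f0 p.1 (q p.1 p.2) * V.f1 p.1 (q p.1 p.2)) :=
    continuous_const.mul ((hU.cont0.comp hqp).mul (hV.cont1.comp hqp))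
  -- Labels as variables turn `L¹` norms into integrals of `|g ∘ q| J`, so the pointwise linear
  -- equation for `u_x J` can be integrated over labels.
  have hcov : ∀ r ∈ Icc 0 τ, ∀ g : ℝ → ℝ,
      ∫⁻ x, ENNReal.ofReal |g x| = ∫⁻ x, ENNReal.ofReal |g (q r x) * J r x| := by
    intro r hr g
    rw [hq.lintegral_comp hr]
    refine lintegral_congr fun x => ?_
    rw [← ENNReal.ofReal_mul (hq.pos_J r x).le, abs_mul, abs_of_pos (hq.pos_J r x), mul_comm]
  have hsτ : s ∈ Icc 0 τ := ⟨hs, hst.trans ht⟩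
  have hpt : ∀ x, |U.f1 t (q t x) * J t x| ≤ Real.exp (C * (t - s)) *
      (|U.f1 s (q s x) * J s x| + ∫ r in s..t, |nonloc₁ U V r (q r x) * J r x|) := by
    intro x
    have := linear_ode_bound (y := fun r => U.f1 r (q r x) * J r x)
      (c := fun r => 2 * (U.f0 r (q r x) * V.f1 r (q r x)))
      (f := fun r => -(nonloc₁ U V r (q r x) * J r x))
      (hcontc.comp (f := fun r : ℝ => (r, x)) (by fun_prop))
      ((hcontf.comp (f := fun r : ℝ => (r, x)) (by fun_prop)).neg)
      (fun r hr => weighted_slope_along hU hV h hq x hr) hs hst ht (C := C)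
      (fun r hr => by rw [abs_mul, abs_two]; exact hC r hr _)
    simpa only [abs_neg] using this
  have hdouble : ∫⁻ x, ENNReal.ofReal (∫ r in s..t, |nonloc₁ U V r (q r x) * J r x|)
      ≤ ENNReal.ofReal (D * (t - s)) := by
    calc ∫⁻ x, ENNReal.ofReal (∫ r in s..t, |nonloc₁ U V r (q r x) * J r x|)
        = ∫⁻ x, ∫⁻ r in Ioc s t, ENNReal.ofReal |nonloc₁ U V r (q r x) * J r x| := by
          refine lintegral_congr fun x => ?_
          rw [intervalIntegral.integral_of_le hst, ofReal_integral_eq_lintegral_ofReal]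
          · have : Continuous fun r => |nonloc₁ U V r (q r x) * J r x| :=
              (hcontf.comp (f := fun r : ℝ => (r, x)) (by fun_prop)).abs
            exact (this.intervalIntegrable s t).1
          · exact ae_of_all _ fun r => abs_nonneg _
      _ = ∫⁻ r in Ioc s t, ∫⁻ x, ENNReal.ofReal |nonloc₁ U V r (q r x) * J r x| := by
          refine lintegral_lintegral_swap (Measurable.aemeasurable ?_)
          have : Continuous fun p : ℝ × ℝ => |nonloc₁ U V p.2 (q p.2 p.1) * J p.2 p.1| :=
            (hcontf.comp (f := fun p : ℝ × ℝ => (p.2, p.1)) (by fun_prop)).abs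
          exact ENNReal.measurable_ofReal.comp this.measurable
      _ ≤ ∫⁻ _ in Ioc s t, ENNReal.ofReal D := by
          refine setLIntegral_mono measurable_const fun r hr => ?_
          rw [← hcov r ⟨hs.trans hr.1.le, hr.2.trans ht⟩]
          exact hDr r (Ioc_subset_Icc_self hr)
      _ = _ := by
          rw [setLIntegral_const, Real.volume_Ioc, ← ENNReal.ofReal_mul hD]
  calc ∫⁻ x, ENNReal.ofReal |U.f1 t x|
      = ∫⁻ x, ENNReal.ofReal |U.f1 t (q t x) * J t x| := hcov t ⟨hs.trans hst, ht⟩ _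
    _ ≤ ∫⁻ x, ENNReal.ofReal (Real.exp (C * (t - s))) * (ENNReal.ofReal |U.f1 s (q s x) * J s x|
          + ENNReal.ofReal (∫ r in s..t, |nonloc₁ U V r (q r x) * J r x|)) := by
        refine lintegral_mono fun x => ?_
        rw [← ENNReal.ofReal_add (abs_nonneg _)
          (intervalIntegral.integral_nonneg hst fun _ _ => abs_nonneg _),
          ← ENNReal.ofReal_mul (Real.exp_pos _).le]
        exact ENNReal.ofReal_le_ofReal (hpt x)
    _ = ENNReal.ofReal (Real.exp (C * (t - s))) * ((∫⁻ x, ENNReal.ofReal |U.f1 s x|)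
          + ∫⁻ x, ENNReal.ofReal (∫ r in s..t, |nonloc₁ U V r (q r x) * J r x|)) := by
        rw [lintegral_const_mul' _ _ ENNReal.ofReal_ne_top, lintegral_add_left, hcov s hsτ (U.f1 s)]
        have : Continuous fun x => |U.f1 s (q s x) * J s x| :=
          (((hU.cont1.comp hqp).mul hq.cont_J).comp (f := fun x : ℝ => (s, x)) (by fun_prop)).abs
        exact ENNReal.measurable_ofReal.comp this.measurable
    _ ≤ ENNReal.ofReal (Real.exp (C * (t - s))) *
          (ENNReal.ofReal A + ENNReal.ofReal (D * (t - s))) := by gcongr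
    _ = _ := by
        rw [← ENNReal.ofReal_add hA (mul_nonneg hD (by linarith)),
          ← ENNReal.ofReal_mul (Real.exp_pos _).le]

/-- Growth of the momentum density of `v`. -/
theorem abs_momentum_le (hU : U.IsRegular K) (hV : V.IsRegular K) (h : Solves V U τ)
    (hq : IsFlow τ (vel U V) (vel₁ U V) q J) {s t A C : ℝ} (hs : 0 ≤ s) (hst : s ≤ t)
    (ht : t ≤ τ) (hC : ∀ r ∈ Icc s t, ∀ x, 3 * |U.f0 r x * V.f1 r x| ≤ C)
    (hAs : ∀ x, |V.f0 s x - V.f2 s x| ≤ A) (x : ℝ) :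
    |V.f0 t x - V.f2 t x| ≤ Real.exp (C * (t - s)) * A := by
  obtain ⟨y, rfl⟩ := (hq.bijective t ⟨hs.trans hst, ht⟩).2 x
  have hqp : Continuous fun p : ℝ × ℝ => (p.1, q p.1 p.2) := continuous_fst.prodMk hq.cont
  have hcontc : Continuous fun p : ℝ × ℝ =>
      -3 * (U.f0 p.1 (q p.1 p.2) * V.f1 p.1 (q p.1 p.2)) :=
    continuous_const.mul ((hU.cont0.comp hqp).mul (hV.cont1.comp hqp))
  have hq' : IsFlow τ (vel V U) (vel₁ V U) q J := by rwa [vel_comm, vel₁_comm]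
  have := linear_ode_bound (y := fun r => V.f0 r (q r y) - V.f2 r (q r y))
    (c := fun r => -3 * (U.f0 r (q r y) * V.f1 r (q r y))) (f := fun _ => 0)
    (hcontc.comp (f := fun r : ℝ => (r, y)) (by fun_prop)) continuous_const
    (fun r hr => by
      rw [add_zero]
      exact momentum_along hV hU h hq' y hr) hs hst ht (C := C)
    (fun r hr => by
      rw [abs_mul, abs_neg, Nat.abs_ofNat]
      exact hC r hr _)
  refine this.trans ?_
  simp only [abs_zero, intervalIntegral.integral_zero, add_zero]
  gcongr
  exact hAs _

/-- The bound `B` on the interval fixes the growth rates, the bound `A` is the value at its start.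
Since `|u v_x| ≤ B²/2`, the exponents are `B²` for the variation and `(3/2) B²` for the momentum;
the larger one serves both. -/
theorem Controlled.step (hU : U.IsRegular K) (hV : V.IsRegular K) (h : Solves U V τ)
    (h' : Solves V U τ) (hq : IsFlow τ (vel U V) (vel₁ U V) q J) {s t A B : ℝ} (hs : 0 ≤ s)
    (hst : s ≤ t) (ht : t ≤ τ) (hB : ∀ r ∈ Icc s t, Controlled U V B r)
    (hA : Controlled U V A s) :
    Controlled U V (Real.exp (3 / 2 * B ^ 2 * (t - s)) * (A + 7 / 2 * B ^ 3 * (t - s))) t := by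
  have hB0 := (hB s ⟨le_rfl, hst⟩).nonneg
  have hA0 := hA.nonneg
  have hts : 0 ≤ t - s := by linarith
  have huv : ∀ r ∈ Icc s t, ∀ x, |U.f0 r x * V.f1 r x| ≤ B ^ 2 / 2 := by
    intro r hr x
    have h1 := (hB r hr).abs_f0_le hU x
    have h2 := (hV.abs_le_momentum (hB r hr).2 x).2.1
    rw [abs_mul]
    calc |U.f0 r x| * |V.f1 r x| ≤ B / 2 * B := by gcongr
      _ = _ := by ring
  constructor
  · refine (lintegral_slope_le hU hV h hq hs hst ht hA0 (D := 7 / 2 * B ^ 3) (by positivity)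
      (C := 3 / 2 * B ^ 2) (fun r hr x => ?_)
      (fun r hr => (hB r hr).lintegral_abs_nonloc₁_le hU hV) hA.1)
    nlinarith [huv r hr x]
  · intro x
    refine (abs_momentum_le hU hV h' hq hs hst ht (C := 3 / 2 * B ^ 2) (fun r hr x => ?_)
      hA.2 x).trans ?_
    · linarith [huv r hr x]
    · gcongr
      have : 0 ≤ 7 / 2 * B ^ 3 * (t - s) := by positivity
      linarith

/-- A crude a priori bound. -/
theorem exists_controlled (hU : U.IsRegular K) (hV : V.IsRegular K) (h : Solves U V τ)
    (hq : IsFlow τ (vel U V) (vel₁ U V) q J) {A : ℝ} (hA : Controlled U V A 0) :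
    ∃ B, ∀ t ∈ Icc 0 τ, Controlled U V B t := by
  have hK := hU.nonneg
  -- Here the bound may depend on the solution: `u u_x` is integrable by Cauchy–Schwarz, which makes
  -- the nonlocal term integrable before any control of the total variation.
  refine ⟨max (2 * K) (Real.exp (2 * K ^ 2 * τ) * (A + 6 * K ^ 3 * τ)), fun t ht => ⟨?_, ?_⟩⟩
  · refine (lintegral_slope_le hU hV h hq le_rfl ht.1 ht.2 hA.nonneg (D := 6 * K ^ 3)
      (by positivity) (C := 2 * K ^ 2) (fun r _ x => ?_)
      (fun r _ => hU.lintegral_abs_nonloc₁_le hV r) hA.1).trans (ENNReal.ofReal_le_ofReal ?_)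
    · rw [abs_mul, sq]
      have h1 := hU.bound0 r x
      have h2 := hV.bound1 r x
      gcongr
    · refine le_trans ?_ (le_max_right _ _)
      have := hA.nonneg
      have := ht.1
      rw [sub_zero]
      have := ht.2
      gcongr
  · intro x
    refine le_trans ?_ (le_max_left _ _)
    have h1 := hV.bound0 t x
    have h2 := hV.bound2 t x
    rw [abs_le] at *
    constructor <;> linarith

theorem exp_three_fortieths_le : Real.exp (3 / 40) ≤ 10 / 9 := by
  have h := Real.add_one_le_exp (-(3 / 40 : ℝ))
  rw [Real.exp_neg] at h
  have hp := Real.exp_pos (3 / 40)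
  have h1 := mul_inv_cancel₀ hp.ne'
  nlinarith

/-- On a short time interval, the quantities controlled grow by at most the factor `3/2`. -/
theorem controlled_of_short_time (hU : U.IsRegular K) (hV : V.IsRegular K) (h : Solves U V τ)
    (h' : Solves V U τ) (hq : IsFlow τ (vel U V) (vel₁ U V) q J) {M t₁ : ℝ} (hM : 0 < M)
    (hM0 : Controlled U V M 0) (ht₁ : t₁ ≤ τ) (hshort : M ^ 2 * t₁ ≤ 1 / 80) :
    ∀ t ∈ Icc 0 t₁, Controlled U V (3 / 2 * M) t := by
  obtain ⟨B, hB⟩ := exists_controlled hU hV h hq hM0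
  -- The crude bound `B` gives a step length `δ`, uniform in time, within which `(3/2) M` cannot
  -- grow past `2M`. This replaces continuity in time of the controlled quantities.
  obtain ⟨δ, hδ, hδB⟩ : ∃ δ > 0, ∀ d, |d| < δ →
      Real.exp (3 / 2 * B ^ 2 * d) * (3 / 2 * M + 7 / 2 * B ^ 3 * d) ≤ 2 * M := by
    have hc : Continuous fun d : ℝ =>
      Real.exp (3 / 2 * B ^ 2 * d) * (3 / 2 * M + 7 / 2 * B ^ 3 * d) := by fun_prop
    have h0 : ∀ᶠ d in 𝓝 (0 : ℝ),
        Real.exp (3 / 2 * B ^ 2 * d) * (3 / 2 * M + 7 / 2 * B ^ 3 * d) < 2 * M := by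
      refine (hc.tendsto 0).eventually_lt_const ?_
      simp only [mul_zero, Real.exp_zero, add_zero, one_mul]
      linarith
    obtain ⟨δ, hδ, h1⟩ := Metric.eventually_nhds_iff.1 h0
    exact ⟨δ, hδ, fun d hd => (h1 (by simpa using hd)).le⟩
  have key : ∀ k : ℕ, ∀ t ∈ Icc 0 t₁, t ≤ k * (δ / 2) → Controlled U V (3 / 2 * M) t := by
    intro k
    induction k with
    | zero =>
      intro t ht htk
      have : t = 0 := le_antisymm (by simpa using htk) ht.1
      rw [this]
      exact hM0.mono (by linarith)
    | succ k ih =>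
      intro t ht htk
      have h2M : ∀ r ∈ Icc 0 t, Controlled U V (2 * M) r := by
        intro r hr
        have hrt₁ := hr.2.trans ht.2
        rcases le_total r (k * (δ / 2)) with hrk | hrk
        · exact (ih r ⟨hr.1, hrt₁⟩ hrk).mono (by linarith)
        · have hs0 : 0 ≤ k * (δ / 2) := by positivity
          refine (Controlled.step hU hV h h' hq hs0 hrk (hrt₁.trans ht₁)
            (fun l hl => hB l ⟨hs0.trans hl.1, hl.2.trans (hrt₁.trans ht₁)⟩)
            (ih _ ⟨hs0, hrk.trans hrt₁⟩ le_rfl)).mono (hδB _ ?_)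
          rw [abs_of_nonneg (by linarith)]
          have := hr.2
          push_cast at htk
          linarith
      -- Restarting from time `0` with the bound `2M` improves it: from `M² t ≤ 1/80` the exponent
      -- is at most `6/80` and the added mass at most `(28/80) M`, and `(10/9) (27/20) = 3/2`.
      refine (Controlled.step hU hV h h' hq le_rfl ht.1 (ht.2.trans ht₁) h2M hM0).mono ?_
      rw [sub_zero]
      have hMt : M ^ 2 * t ≤ 1 / 80 := le_trans (by gcongr; exact ht.2) hshort
      have e1 : 3 / 2 * (2 * M) ^ 2 * t ≤ 3 / 40 := by nlinarith
      have e2 : M + 7 / 2 * (2 * M) ^ 3 * t ≤ 27 / 20 * M := by nlinarith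
      have ht0 := ht.1
      calc Real.exp (3 / 2 * (2 * M) ^ 2 * t) * (M + 7 / 2 * (2 * M) ^ 3 * t)
          ≤ 10 / 9 * (27 / 20 * M) := by
            refine mul_le_mul ((Real.exp_le_exp.2 e1).trans exp_three_fortieths_le) e2
              (by positivity) (by norm_num)
        _ = 3 / 2 * M := by ring
  intro t ht
  obtain ⟨k, hk⟩ := exists_nat_ge (t / (δ / 2))
  exact key k t ht ((div_le_iff₀ (by positivity)).1 hk)

end Jet

end Estimates

end GengXue

namespace GengXue

/-! ### Riccati comparison and the algebra of the constants. -/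

section Riccati

open Filter Topology

/-- A differential inequality of Riccati type, below the lower equilibrium `-y`. -/
theorem riccati_comparison {w w' : ℝ → ℝ} {y c τ : ℝ} (hy : 0 < y) (hc : 0 < c)
    (hw : ∀ t ∈ Icc 0 τ, HasDerivWithinAt w (w' t) (Icc 0 τ) t)
    (hw' : ∀ t ∈ Icc 0 τ, w' t ≤ -(c / (2 * y)) * (w t ^ 2 - y ^ 2)) (h0 : w 0 < -y) :
    ∀ t ∈ Icc 0 τ, w t < -y ∧
      Real.log ((w t - y) / (w t + y)) ≤ Real.log ((w 0 - y) / (w 0 + y)) - c * t := by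
  have hcont : ContinuousOn w (Icc 0 τ) := fun t ht => (hw t ht).continuousWithinAt
  have hcy : 0 < c / (2 * y) := by positivity
  -- The starting value is a barrier: wherever `w = w 0 < -y`, the inequality makes `w'` strictly
  -- negative.
  have hle : ∀ t ∈ Icc 0 τ, w t ≤ w 0 := by
    intro t ht
    refine image_le_of_deriv_right_lt_deriv_boundary' (f := w) (f' := w') (B := fun _ => w 0)
      (B' := fun _ => 0) hcont
      (fun r hr => hasDerivWithinAt_Ici_of_Icc (hw r (Ico_subset_Icc_self hr)) hr) le_rfl
      continuousOn_const (fun r _ => hasDerivWithinAt_const _ _ _) (fun r hr hwr => ?_) ht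
    have h1 := hw' r (Ico_subset_Icc_self hr)
    rw [hwr] at h1
    have h2 : 0 < w 0 ^ 2 - y ^ 2 := by nlinarith
    nlinarith [mul_pos hcy h2]
  have hlt : ∀ t ∈ Icc 0 τ, w t < -y := fun t ht => (hle t ht).trans_lt h0
  have hlog : ∀ t ∈ Icc 0 τ, Real.log ((w t - y) / (w t + y)) =
      Real.log (y - w t) - Real.log (-y - w t) := by
    intro t ht
    have := hlt t ht
    rw [← Real.log_div (by linarith) (by linarith), ← neg_div_neg_eq]
    ring_nf
  intro t ht
  refine ⟨hlt t ht, ?_⟩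
  have h00 : (0 : ℝ) ∈ Icc 0 τ := ⟨le_rfl, ht.1.trans ht.2⟩
  rw [hlog t ht, hlog 0 h00]
  have hd : ∀ r ∈ Icc 0 τ, HasDerivWithinAt (fun r => Real.log (y - w r) - Real.log (-y - w r))
      (-w' r / (y - w r) - -w' r / (-y - w r)) (Icc 0 τ) r := by
    intro r hr
    have := hlt r hr
    exact (((hw r hr).const_sub y).log (by linarith)).sub
      (((hw r hr).const_sub (-y)).log (by linarith))
  refine image_le_of_deriv_right_le_deriv_boundary
    (f := fun r => Real.log (y - w r) - Real.log (-y - w r))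
    (f' := fun r => -w' r / (y - w r) - -w' r / (-y - w r))
    (B := fun r => Real.log (y - w 0) - Real.log (-y - w 0) - c * r) (B' := fun _ => -c)
    (fun r hr => (hd r hr).continuousWithinAt)
    (fun r hr => hasDerivWithinAt_Ici_of_Icc (hd r (Ico_subset_Icc_self hr)) hr) (by simp)
    (by fun_prop) (fun r _ => ?_) (fun r hr => ?_) ht
  · simpa using! (((hasDerivAt_id r).const_mul c).const_sub
      (Real.log (y - w 0) - Real.log (-y - w 0))).hasDerivWithinAt
  · have h1 := hlt r (Ico_subset_Icc_self hr)
    have h2 := hw' r (Ico_subset_Icc_self hr)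
    have h3 : 0 < y - w r := by linarith
    have h4 : 0 < -y - w r := by linarith
    -- The logarithm has derivative `2y w' / (w² - y²)`, so the Riccati inequality says exactly that
    -- it is at most `-c`.
    have e : -w' r / (y - w r) - -w' r / (-y - w r)
        = w' r * (2 * y) / ((y - w r) * (-y - w r)) := by
      field_simp
      ring
    rw [e, div_le_iff₀ (mul_pos h3 h4)]
    calc w' r * (2 * y) ≤ -(c / (2 * y)) * (w r ^ 2 - y ^ 2) * (2 * y) := by gcongr
      _ = -c * ((y - w r) * (-y - w r)) := by field_simp; ring

/-- Below `-y` the quotient `(w-y)/(w+y)` exceeds `1`, so its logarithm is positive. The conclusion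
`0 < l` is what bounds the lifespan; solving for `w` gives the bound of the slope. -/
theorem le_coth_of_log_le {w y l : ℝ} (hw : w < -y) (hy : 0 < y)
    (h : Real.log ((w - y) / (w + y)) ≤ l) :
    0 < l ∧ w ≤ (1 + Real.exp l) / (1 - Real.exp l) * y := by
  have e : (w - y) / (w + y) = (y - w) / (-y - w) := by
    rw [← neg_div_neg_eq]; ring_nf
  have h4 : 0 < -y - w := by linarith
  have h1 : 1 < (y - w) / (-y - w) := by
    rw [lt_div_iff₀ h4]; linarith
  rw [e] at h
  have hl : 0 < l := (Real.log_pos h1).trans_le h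
  refine ⟨hl, ?_⟩
  have hE : 1 < Real.exp l := Real.one_lt_exp_iff.2 hl
  have h2 := (Real.log_le_iff_le_exp (by linarith)).1 h
  rw [div_le_iff₀ h4] at h2
  rw [div_mul_eq_mul_div, le_div_iff_of_neg (by linarith)]
  nlinarith

theorem log_le_of_le_coth {w y l : ℝ} (hy : 0 < y) (hl : 0 < l)
    (h : w ≤ (1 + Real.exp l) / (1 - Real.exp l) * y) :
    w < -y ∧ 0 < Real.log ((w - y) / (w + y)) ∧ Real.log ((w - y) / (w + y)) ≤ l := by
  have hE : 1 < Real.exp l := Real.one_lt_exp_iff.2 hl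
  rw [div_mul_eq_mul_div, le_div_iff_of_neg (by linarith)] at h
  have hw : w < -y := by nlinarith
  have e : (w - y) / (w + y) = (y - w) / (-y - w) := by
    rw [← neg_div_neg_eq]; ring_nf
  have h4 : 0 < -y - w := by linarith
  have h1 : 1 < (y - w) / (-y - w) := by
    rw [lt_div_iff₀ h4]; linarith
  rw [e]
  refine ⟨hw, Real.log_pos h1, (Real.log_le_iff_le_exp (by linarith)).2 ?_⟩
  rw [div_le_iff₀ h4]
  nlinarith

/-- The algebra behind the Riccati inequality of the slope. -/
theorem slopeRate_le {m v₀ M v u vx w F : ℝ} (hm : 0 < v₀) (hM : 0 < M)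
    (hv : 17 / 20 * v₀ ≤ v) (hu : |u| ≤ 3 / 4 * M) (hvx : |vx| ≤ 3 / 2 * M)
    (hF : |F| ≤ 7 / 4 * (3 / 2 * M) ^ 3) (hmb : m = 4 / v₀ * M ^ 4 + 14 * M ^ 3) :
    -(v * w ^ 2) + u * vx * w - F ≤ -(11 / 10) * (v₀ / 2 * w ^ 2 - m / 2) := by
  have huv : |u * vx| ≤ 9 / 8 * M ^ 2 := by
    rw [abs_mul]
    calc |u| * |vx| ≤ 3 / 4 * M * (3 / 2 * M) := by gcongr
      _ = _ := by ring
  have h1 : u * vx * w ≤ 9 / 8 * M ^ 2 * |w| := by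
    refine (le_abs_self _).trans ?_
    rw [abs_mul]
    gcongr
  have h2 : 17 / 20 * v₀ * w ^ 2 ≤ v * w ^ 2 := by gcongr
  have h3 : -F ≤ 7 / 4 * (3 / 2 * M) ^ 3 := (neg_le_abs F).trans hF
  -- Young's inequality by completing a square: `3/10 = 17/20 - 11/20` is the share of `v₀ w²` that
  -- can be spent, and `11/5 = (11/20) · 4` the share of `b₁` available for `M⁴/v₀`.
  have h4 : 9 / 8 * M ^ 2 * |w| ≤ 3 / 10 * v₀ * w ^ 2 + 11 / 5 * (M ^ 4 / v₀) := by
    have h5 : 0 ≤ (3 / 10 * v₀ * |w| - 9 / 16 * M ^ 2) ^ 2 / v₀ := by positivity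
    have h6 : (3 / 10 * v₀ * |w| - 9 / 16 * M ^ 2) ^ 2 / v₀ =
        9 / 100 * v₀ * |w| ^ 2 - 27 / 80 * M ^ 2 * |w| + 81 / 256 * (M ^ 4 / v₀) := by
      field_simp
      ring
    rw [sq_abs] at h6
    have h7 : 0 ≤ M ^ 4 / v₀ := by positivity
    nlinarith
  have h8 : 4 / v₀ * M ^ 4 = 4 * (M ^ 4 / v₀) := by ring
  rw [hmb, h8]
  -- The cubic terms fit because `(7/4) (3/2)³ = 189/32` is below `(11/20) · 14 = 77/10`.
  have h9 : 0 < M ^ 3 := by positivity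
  nlinarith

end Riccati

end GengXue

namespace GengXue

/-! ### From strong solutions to regular jets on compact time intervals. -/

section StrongSolution

open Filter Topology

theorem Jet.IsRegular.mono {U : Jet} {K L : ℝ} (h : U.IsRegular K) (hKL : K ≤ L) :
    U.IsRegular L :=
  ⟨h.deriv0, h.deriv1, h.cont0, h.cont1, h.cont2, fun t x => (h.bound0 t x).trans hKL,
    fun t x => (h.bound1 t x).trans hKL, fun t x => (h.bound2 t x).trans hKL,
    fun t => (h.sq0 t).trans (ENNReal.ofReal_le_ofReal hKL),
    fun t => (h.sq1 t).trans (ENNReal.ofReal_le_ofReal hKL), h.lim⟩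

/-- The jet of `w` on `[0,τ]`, extended by constants in time. -/
noncomputable def jetOf (τ : ℝ) (w : ℝ → ℝ → ℝ) : Jet where
  f0 t := w (clamp τ t)
  f1 t := deriv (w (clamp τ t))
  f2 t := deriv (deriv (w (clamp τ t)))

theorem continuous_of_uniform {f : ℝ → ℝ → ℝ} {W : ℝ → Lp ℂ 2 (volume : Measure ℝ)} {C : ℝ}
    (hW : Continuous W) (hf : ∀ t, Continuous (f t))
    (h : ∀ t s x, |f t x - f s x| ≤ C * ‖W t - W s‖) :
    Continuous fun p : ℝ × ℝ => f p.1 p.2 := by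
  refine continuous_iff_continuousAt.2 fun p => tendsto_iff_dist_tendsto_zero.2 ?_
  refine squeeze_zero (g := fun p' : ℝ × ℝ => C * ‖W p'.1 - W p.1‖ + |f p.1 p'.2 - f p.1 p.2|)
    (fun _ => dist_nonneg) (fun p' => ?_) ?_
  · rw [Real.dist_eq]
    calc |f p'.1 p'.2 - f p.1 p.2|
        = |(f p'.1 p'.2 - f p.1 p'.2) + (f p.1 p'.2 - f p.1 p.2)| := by ring_nf
      _ ≤ _ := (abs_add_le _ _).trans (add_le_add (h _ _ _) le_rfl)
  · have hfp := hf p.1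
    have hc : Continuous fun p' : ℝ × ℝ =>
        C * ‖W p'.1 - W p.1‖ + |f p.1 p'.2 - f p.1 p.2| := by fun_prop
    simpa using hc.tendsto p

theorem ContinuousInHs.exists_isRegular {s T τ : ℝ} (hs : 5 / 2 < s) {w : ℝ → ℝ → ℝ}
    (h : ContinuousInHs s T w) (hτ : 0 ≤ τ) (hτT : τ < T) : ∃ K, (jetOf τ w).IsRegular K := by
  obtain ⟨hc, W, hW, hB⟩ := h
  obtain ⟨C, hC0, hC⟩ := exists_sobolev_bound hs
  have hmem : ∀ t, clamp τ t ∈ Ico 0 T := fun t =>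
    ⟨(clamp_mem hτ t).1, (clamp_mem hτ t).2.trans_lt hτT⟩
  have hWc : Continuous fun t => W (clamp τ t) := hW.comp_continuous (continuous_clamp τ) hmem
  obtain ⟨K, hK⟩ := (isCompact_Icc (a := (0 : ℝ)) (b := τ)).exists_bound_of_continuousOn
    (hW.mono fun t ht => ⟨ht.1, ht.2.trans_lt hτT⟩)
  have hKt : ∀ t, C * ‖W (clamp τ t)‖ ≤ C * K := fun t =>
    mul_le_mul_of_nonneg_left (hK _ (clamp_mem hτ t)) hC0
  have key := fun t => hC _ _ (hc _ (hmem t)) (hB _ (hmem t))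
  -- Applied to differences, the Sobolev bound turns continuity in `Hˢ` into continuity in time,
  -- uniform in `x`, of `w`, `w_x` and `w_xx`.
  have diff := fun t t' => hC (fun x => w (clamp τ t) x - w (clamp τ t') x) _ ((hc _ (hmem t)).sub (hc _ (hmem t')))
    ((hB _ (hmem t)).sub (hB _ (hmem t')))
  have e1 : ∀ t t', deriv (fun x => w (clamp τ t) x - w (clamp τ t') x)
      = fun x => deriv (w (clamp τ t)) x - deriv (w (clamp τ t')) x := fun t t' =>
    funext fun x => (((key t).1 x).sub ((key t').1 x)).deriv
  have e2 : ∀ t t', deriv (deriv (fun x => w (clamp τ t) x - w (clamp τ t') x))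
      = fun x => deriv (deriv (w (clamp τ t))) x - deriv (deriv (w (clamp τ t'))) x :=
    fun t t' => by
      rw [e1]
      exact funext fun x => (((key t).2.1 x).sub ((key t').2.1 x)).deriv
  refine ⟨C * K, fun t => (key t).1, fun t => (key t).2.1,
    continuous_of_uniform (C := C) hWc (fun t => hc _ (hmem t))
      fun t t' x => (diff t t').2.2.2.1 x,
    continuous_of_uniform (C := C) hWc
      (fun t => continuous_iff_continuousAt.2 fun x => ((key t).2.1 x).continuousAt)
      fun t t' x => ?_,
    continuous_of_uniform (C := C) hWc (fun t => (key t).2.2.1) fun t t' x => ?_,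
    fun t x => ((key t).2.2.2.1 x).trans (hKt t), fun t x => ((key t).2.2.2.2.1 x).trans (hKt t),
    fun t x => ((key t).2.2.2.2.2.1 x).trans (hKt t),
    fun t => (key t).2.2.2.2.2.2.1.trans (ENNReal.ofReal_le_ofReal (hKt t)),
    fun t => (key t).2.2.2.2.2.2.2.1.trans (ENNReal.ofReal_le_ofReal (hKt t)),
    fun t => (key t).2.2.2.2.2.2.2.2⟩
  · have := (diff t t').2.2.2.2.1 x
    rwa [e1] at this
  · have := (diff t t').2.2.2.2.2.1 x
    rwa [e2] at this

/-- Integration by parts brings the nonlocal term of the system into a form without `u_xx`. -/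
theorem Jet.nonloc_eq {U V : Jet} {K : ℝ} (hU : U.IsRegular K) (hV : V.IsRegular K) (t x : ℝ) :
    Jet.nonloc U V t x = conv green (fun y => 3 * U.f0 t y * V.f0 t y * U.f1 t y
      + 2 * U.f0 t y * V.f1 t y * U.f2 t y + 2 * U.f1 t y ^ 2 * V.f1 t y
      + U.f0 t y * V.f2 t y * U.f1 t y) x := by
  have u0 := Jet.continuous_slice hU.cont0 t
  have u1 := Jet.continuous_slice hU.cont1 t
  have u2 := Jet.continuous_slice hU.cont2 t
  have v1 := Jet.continuous_slice hV.cont1 t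
  have v2 := Jet.continuous_slice hV.cont2 t
  set g' : ℝ → ℝ := fun y => 2 * (U.f1 t y * U.f1 t y * V.f1 t y + U.f0 t y * U.f2 t y * V.f1 t y
    + U.f0 t y * U.f1 t y * V.f2 t y) with hg'
  have hgd : ∀ y, HasDerivAt (Jet.srcB U V t) (g' y) y := by
    intro y
    convert! (((hU.deriv0 t y).const_mul 2).mul (hU.deriv1 t y)).mul (hV.deriv1 t y) using 1
    simp only [hg', Pi.mul_apply]; ring
  have hg'c : Continuous g' := by fun_prop
  have hg'b : ∀ y, |g' y| ≤ 2 * (K * K * K + K * K * K + K * K * K) := by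
    intro y
    simp only [hg']
    rw [abs_mul, abs_two]
    gcongr
    exact (abs_add_three _ _ _).trans (add_le_add (add_le_add
      (Jet.abs_mul_mul_le (hU.bound1 t y) (hU.bound1 t y) (hV.bound1 t y))
      (Jet.abs_mul_mul_le (hU.bound0 t y) (hU.bound2 t y) (hV.bound1 t y)))
      (Jet.abs_mul_mul_le (hU.bound0 t y) (hU.bound1 t y) (hV.bound2 t y)))
  have e : (fun y => 3 * U.f0 t y * V.f0 t y * U.f1 t y
      + 2 * U.f0 t y * V.f1 t y * U.f2 t y + 2 * U.f1 t y ^ 2 * V.f1 t y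
      + U.f0 t y * V.f2 t y * U.f1 t y) = fun y => Jet.srcA U V t y + g' y := by
    ext y
    simp only [Jet.srcA, hg']
    ring
  rw [e, isKernel_green.conv_add (Jet.continuous_slice (Jet.continuous_srcA hU hV) t) hg'c
    (Jet.abs_srcA_le hU hV t) hg'b, conv_green_deriv hgd (Jet.abs_srcB_le hU hV t) hg'c hg'b]
  rfl

theorem solves_jetOf {T τ : ℝ} {u v : ℝ → ℝ → ℝ} {K : ℝ} (hτT : τ < T)
    (hU : (jetOf τ u).IsRegular K) (hV : (jetOf τ v).IsRegular K)
    (h : ∀ t ∈ Ico 0 T, ∀ x,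
      HasDerivWithinAt (fun r => u r x) (rhs (u t) (v t) x) (Ico 0 T) t) :
    Jet.Solves (jetOf τ u) (jetOf τ v) τ := by
  intro x t ht
  have hsub : Icc 0 τ ⊆ Ico 0 T := fun r hr => ⟨hr.1, hr.2.trans_lt hτT⟩
  have h1 := (h t (hsub ht) x).mono hsub
  have e : rhs (u t) (v t) x = -((jetOf τ u).f0 t x * (jetOf τ v).f0 t x * (jetOf τ u).f1 t x
      + Jet.nonloc (jetOf τ u) (jetOf τ v) t x) := by
    rw [Jet.nonloc_eq hU hV]
    simp only [jetOf, clamp_of_mem ht]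
    rfl
  rw [← e]
  refine h1.congr (fun r hr => ?_) ?_
  · simp only [jetOf, clamp_of_mem hr]
  · simp only [jetOf, clamp_of_mem ht]

/-- For continuous `f` the set where `|f|` exceeds its essential supremum is open and null, hence
empty. Boundedness keeps the norm finite, so that `toReal` does not collapse to `0`. -/
theorem abs_le_eLpNorm_top_toReal {f : ℝ → ℝ} (hf : Continuous f) {C : ℝ} (hC : ∀ x, |f x| ≤ C)
    (x : ℝ) : |f x| ≤ (eLpNorm f ⊤ volume).toReal := by
  have hfin : eLpNorm f ⊤ volume ≠ ⊤ :=
    (memLp_top_of_bound hf.aestronglyMeasurable C (ae_of_all _ hC)).2.ne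
  have hae : ∀ᵐ y, |f y| ≤ (eLpNorm f ⊤ volume).toReal := by
    filter_upwards [ae_le_eLpNormEssSup (f := f) (μ := volume)] with y hy
    rw [← eLpNorm_exponent_top] at hy
    have := ENNReal.toReal_mono hfin hy
    simpa using this
  have hopen : IsOpen {y | (eLpNorm f ⊤ volume).toReal < |f y|} :=
    isOpen_lt continuous_const hf.abs
  have hnull : volume {y | (eLpNorm f ⊤ volume).toReal < |f y|} = 0 := by
    have := ae_iff.1 hae
    simpa only [not_le] using this
  have hempty := hopen.eq_empty_of_measure_zero hnull
  by_contra hx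
  have : x ∈ {y | (eLpNorm f ⊤ volume).toReal < |f y|} := not_le.1 hx
  rw [hempty] at this
  exact this

theorem normW11_nonneg (f : ℝ → ℝ) : 0 ≤ normW11 f :=
  add_nonneg (integral_nonneg fun _ => abs_nonneg _) (integral_nonneg fun _ => abs_nonneg _)

theorem MemHs.abs_le {s : ℝ} (hs : 5 / 2 < s) {f : ℝ → ℝ} (h : MemHs s f) (x : ℝ) :
    |f x - deriv (deriv f) x| ≤ normMomentum f ∧ |f x| ≤ normMomentum f := by
  obtain ⟨hc, g, hg⟩ := h
  -- A single function is treated as a curve constant in time, on the degenerate interval `τ = 0`.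
  obtain ⟨K, hK⟩ := ContinuousInHs.exists_isRegular (T := 1) (τ := 0) (w := fun _ => f) hs
    ⟨fun _ _ => hc, fun _ => g, continuousOn_const, fun _ _ => hg⟩ le_rfl one_pos
  have h2 : ∀ x, |f x - deriv (deriv f) x| ≤ normMomentum f := by
    refine fun x => abs_le_eLpNorm_top_toReal (f := fun x => f x - deriv (deriv f) x)
      (C := K + K) (hc.sub (Jet.continuous_slice hK.cont2 0)) (fun x => ?_) x
    exact (abs_sub _ _).trans (add_le_add (hK.bound0 0 x) (hK.bound2 0 x))
  exact ⟨h2 x, (hK.abs_le_momentum (t := 0) h2 x).1⟩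

theorem lintegral_abs_deriv_le {f : ℝ → ℝ} (h : MemW11 f) :
    ∫⁻ x, ENNReal.ofReal |deriv f x| ≤ ENNReal.ofReal (normW11 f) := by
  rw [← ofReal_integral_eq_lintegral_ofReal h.2.2.abs (ae_of_all _ fun _ => abs_nonneg _)]
  refine ENNReal.ofReal_le_ofReal ?_
  unfold normW11
  have : 0 ≤ ∫ x, |f x| := integral_nonneg fun _ => abs_nonneg _
  linarith

/-- Trajectories on the compact subintervals of `[0,T)` fit together. -/
theorem exists_glued_trajectory {F : ℝ → ℝ → ℝ} {T : ℝ} {Q : ℝ → ℝ → ℝ}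
    (hQ : ∀ τ ∈ Ioo 0 T, ∀ t ∈ Icc 0 τ,
      HasDerivWithinAt (Q τ) (F t (Q τ t)) (Icc 0 τ) t)
    (hQQ : ∀ τ ∈ Ioo 0 T, ∀ τ' ∈ Ioo 0 T, τ ≤ τ' → ∀ t ∈ Icc 0 τ, Q τ t = Q τ' t) :
    ∃ q : ℝ → ℝ, (∀ τ ∈ Ioo 0 T, ∀ t ∈ Icc 0 τ, q t = Q τ t) ∧
      ∀ t ∈ Ico 0 T, HasDerivWithinAt q (F t (q t)) (Ico 0 T) t := by
  have hmid : ∀ t ∈ Ico 0 T, (t + T) / 2 ∈ Ioo 0 T ∧ t < (t + T) / 2 := fun t ht =>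
    ⟨⟨by linarith [ht.1, ht.2], by linarith [ht.2]⟩, by linarith [ht.2]⟩
  have hq : ∀ τ ∈ Ioo 0 T, ∀ t ∈ Icc 0 τ, Q ((t + T) / 2) t = Q τ t := by
    intro τ hτ t ht
    obtain ⟨hm, htm⟩ := hmid t ⟨ht.1, ht.2.trans_lt hτ.2⟩
    rcases le_total τ ((t + T) / 2) with h | h
    · exact (hQQ τ hτ _ hm h t ht).symm
    · exact hQQ _ hm τ hτ h t ⟨ht.1, htm.le⟩
  -- The midpoint `(t + T)/2` is a compact interval's end strictly between `t` and `T`, so a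
  -- neighbourhood of `t` in `[0,T)` is covered by one trajectory.
  refine ⟨fun t => Q ((t + T) / 2) t, hq, fun t ht => ?_⟩
  obtain ⟨hm, htm⟩ := hmid t ht
  have hnhds : Icc 0 ((t + T) / 2) ∈ 𝓝[Ico 0 T] t := by
    filter_upwards [self_mem_nhdsWithin, mem_nhdsWithin_of_mem_nhds (Iio_mem_nhds htm)] with r h1 h2
    exact ⟨h1.1, le_of_lt h2⟩
  have h1 := (hQ _ hm t ⟨ht.1, htm.le⟩).mono_of_mem_nhdsWithin hnhds
  refine h1.congr_of_eventuallyEq ?_ rfl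
  filter_upwards [hnhds] with r hr
  exact hq _ hm r hr

end StrongSolution

end GengXue

namespace GengXue

/-! ### The slope along the characteristic from `x₀`. -/

section BlowUp

open Filter Topology

variable {s : ℝ} {u₀ v₀ : ℝ → ℝ} {x₀ : ℝ}

theorem normMomentum_nonneg (f : ℝ → ℝ) : 0 ≤ normMomentum f := ENNReal.toReal_nonneg

theorem value_le_size (hs : 5 / 2 < s) (hv₀ : MemHs s v₀) : v₀ x₀ ≤ size u₀ v₀ :=
  ((le_abs_self _).trans (hv₀.abs_le hs x₀).2).trans
    (le_add_of_nonneg_right (normW11_nonneg u₀))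

theorem b₁_pos (hx₀ : 0 < v₀ x₀) (hM : 0 < size u₀ v₀) : 0 < b₁ u₀ v₀ x₀ := by
  unfold b₁; positivity

theorem sqrt_b₁_mul (hx₀ : 0 < v₀ x₀) :
    √(b₁ u₀ v₀ x₀ * v₀ x₀) = v₀ x₀ * √(b₁ u₀ v₀ x₀ / v₀ x₀) := by
  rw [← Real.sqrt_sq hx₀.le, ← Real.sqrt_mul (sq_nonneg _), Real.sqrt_sq hx₀.le]
  congr 1
  field_simp

theorem sqrt_mul_T₂ (hx₀ : 0 < v₀ x₀) :
    √(b₁ u₀ v₀ x₀ * v₀ x₀) * T₂ u₀ v₀ x₀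
      = √(b₁ u₀ v₀ x₀ * v₀ x₀ ^ 3) / (80 * size u₀ v₀ ^ 3) := by
  have e : b₁ u₀ v₀ x₀ * v₀ x₀ ^ 3 = b₁ u₀ v₀ x₀ * v₀ x₀ * v₀ x₀ ^ 2 := by ring
  rw [e, Real.sqrt_mul' _ (sq_nonneg _), Real.sqrt_sq hx₀.le, T₂, mul_div_assoc]

theorem T₀_eq (hx₀ : 0 < v₀ x₀) :
    T₀ u₀ v₀ x₀ = 1 / √(b₁ u₀ v₀ x₀ * v₀ x₀) *
      Real.log ((deriv u₀ x₀ - √(b₁ u₀ v₀ x₀ / v₀ x₀)) /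
        (deriv u₀ x₀ + √(b₁ u₀ v₀ x₀ / v₀ x₀))) := by
  have hv := Real.sqrt_pos.2 hx₀
  rw [T₀, Real.sqrt_div' _ hx₀.le,
    ← mul_div_mul_left (deriv u₀ x₀ - √(b₁ u₀ v₀ x₀) / √(v₀ x₀)) _ hv.ne']
  congr 3 <;> field_simp

/-- The slope condition puts the slope below the unstable equilibrium, and `0 < T₀ ≤ T₂`. -/
theorem slope_condition (hx₀ : 0 < v₀ x₀) (hM : 0 < size u₀ v₀)
    (hslope : deriv u₀ x₀ ≤
      (1 + Real.exp (√(b₁ u₀ v₀ x₀ * v₀ x₀ ^ 3) / (80 * size u₀ v₀ ^ 3))) /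
        (1 - Real.exp (√(b₁ u₀ v₀ x₀ * v₀ x₀ ^ 3) / (80 * size u₀ v₀ ^ 3))) *
        √(b₁ u₀ v₀ x₀ / v₀ x₀)) :
    deriv u₀ x₀ < -√(b₁ u₀ v₀ x₀ / v₀ x₀) ∧ 0 < T₀ u₀ v₀ x₀ ∧ T₀ u₀ v₀ x₀ ≤ T₂ u₀ v₀ x₀ := by
  have hb := b₁_pos hx₀ hM
  have hy : 0 < √(b₁ u₀ v₀ x₀ / v₀ x₀) := Real.sqrt_pos.2 (by positivity)
  have hκ : 0 < √(b₁ u₀ v₀ x₀ * v₀ x₀) := Real.sqrt_pos.2 (by positivity)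
  have hT₂ : 0 < T₂ u₀ v₀ x₀ := by unfold T₂; positivity
  rw [← sqrt_mul_T₂ hx₀] at hslope
  obtain ⟨h1, h2, h3⟩ := log_le_of_le_coth hy (mul_pos hκ hT₂) hslope
  refine ⟨h1, ?_, ?_⟩
  · rw [T₀_eq hx₀]; positivity
  · rw [T₀_eq hx₀, one_div_mul_eq_div, div_le_iff₀' hκ]
    exact h3

/-- All estimates meet here, on a compact `[0,τ]` inside the lifespan. The Riccati inequality holds
with the factor `11/10`, which limits `τ`; the bound of the slope is stated with the weaker rate
`κ`. -/
theorem IsStrongSolution.slope_bound (hs : 5 / 2 < s) (hu₀ : MemW11 u₀) (hv₀ : MemHs s v₀)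
    (hx₀ : 0 < v₀ x₀)
    (hslope : deriv u₀ x₀ ≤
      (1 + Real.exp (√(b₁ u₀ v₀ x₀ * v₀ x₀ ^ 3) / (80 * size u₀ v₀ ^ 3))) /
        (1 - Real.exp (√(b₁ u₀ v₀ x₀ * v₀ x₀ ^ 3) / (80 * size u₀ v₀ ^ 3))) *
        √(b₁ u₀ v₀ x₀ / v₀ x₀))
    {T : ℝ} {u v : ℝ → ℝ → ℝ} (h : IsStrongSolution s T u₀ v₀ u v) {τ : ℝ} (hτ : τ ∈ Ioo 0 T) :
    11 / 10 * τ < T₀ u₀ v₀ x₀ ∧ ∃ q : ℝ → ℝ, q 0 = x₀ ∧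
      (∀ t ∈ Icc 0 τ, HasDerivWithinAt q (u t (q t) * v t (q t)) (Icc 0 τ) t) ∧
      ∀ t ∈ Icc 0 τ, deriv (u t) (q t) ≤
          (1 + Real.exp (√(b₁ u₀ v₀ x₀ * v₀ x₀) * (T₀ u₀ v₀ x₀ - t))) /
            (1 - Real.exp (√(b₁ u₀ v₀ x₀ * v₀ x₀) * (T₀ u₀ v₀ x₀ - t))) *
            √(b₁ u₀ v₀ x₀ / v₀ x₀) := by
  have hvM := value_le_size (u₀ := u₀) (x₀ := x₀) hs hv₀
  have hM : 0 < size u₀ v₀ := hx₀.trans_le hvM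
  obtain ⟨hw0, hT₀, hT₀₂⟩ := slope_condition hx₀ hM hslope
  have hb := b₁_pos hx₀ hM
  have hy : 0 < √(b₁ u₀ v₀ x₀ / v₀ x₀) := Real.sqrt_pos.2 (by positivity)
  have hy2 : √(b₁ u₀ v₀ x₀ / v₀ x₀) ^ 2 = b₁ u₀ v₀ x₀ / v₀ x₀ := Real.sq_sqrt (by positivity)
  have hκ : 0 < √(b₁ u₀ v₀ x₀ * v₀ x₀) := Real.sqrt_pos.2 (by positivity)
  have hκy := sqrt_b₁_mul (u₀ := u₀) hx₀
  have hT₀e := T₀_eq (u₀ := u₀) hx₀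
  have hbdef : b₁ u₀ v₀ x₀ = 4 / v₀ x₀ * size u₀ v₀ ^ 4 + 14 * size u₀ v₀ ^ 3 := rfl
  have hT₂def : T₂ u₀ v₀ x₀ = v₀ x₀ / (80 * size u₀ v₀ ^ 3) := rfl
  set M := size u₀ v₀ with hMdef
  set y := √(b₁ u₀ v₀ x₀ / v₀ x₀) with hydef
  set κ := √(b₁ u₀ v₀ x₀ * v₀ x₀) with hκdef
  set S := T₀ u₀ v₀ x₀ with hSdef
  have hκS : Real.log ((deriv u₀ x₀ - y) / (deriv u₀ x₀ + y)) = κ * S := by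
    rw [hT₀e]; field_simp
  have hM3T : M ^ 3 * T₂ u₀ v₀ x₀ = v₀ x₀ / 80 := by
    rw [hT₂def]; field_simp
  -- This uses `v₀(x₀) ≤ M`.
  have hM2T : M ^ 2 * T₂ u₀ v₀ x₀ ≤ 1 / 80 := by
    have : M * (M ^ 2 * T₂ u₀ v₀ x₀) ≤ M * (1 / 80) := by nlinarith
    exact le_of_mul_le_mul_left this hM
  obtain ⟨K₁, hK₁⟩ := h.regular_u.exists_isRegular hs hτ.1.le hτ.2
  obtain ⟨K₂, hK₂⟩ := h.regular_v.exists_isRegular hs hτ.1.le hτ.2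
  have hU := hK₁.mono (le_max_left K₁ K₂)
  have hV := hK₂.mono (le_max_right K₁ K₂)
  have hSU := solves_jetOf hτ.2 hU hV h.eq_u
  have hSV := solves_jetOf hτ.2 hV hU h.eq_v
  obtain ⟨q, J, hq⟩ := (Jet.isVelocity hU hV).exists_flow hτ.1.le
  have hq' : IsFlow τ (Jet.vel (jetOf τ v) (jetOf τ u)) (Jet.vel₁ (jetOf τ v) (jetOf τ u)) q J := by
    rwa [Jet.vel_comm, Jet.vel₁_comm]
  have h0 : (0 : ℝ) ∈ Icc 0 τ := ⟨le_rfl, hτ.1.le⟩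
  have hM0 : Jet.Controlled (jetOf τ u) (jetOf τ v) M 0 := by
    constructor
    · simp only [jetOf, clamp_of_mem h0, h.init_u]
      refine (lintegral_abs_deriv_le hu₀).trans (ENNReal.ofReal_le_ofReal ?_)
      exact le_add_of_nonneg_left (normMomentum_nonneg v₀)
    · intro x
      simp only [jetOf, clamp_of_mem h0, h.init_v]
      exact (hv₀.abs_le hs x).1.trans (le_add_of_nonneg_right (normW11_nonneg u₀))
  -- The control is valid only up to `T₂`; once `τ < T₀ ≤ T₂` is known, `t₁` turns out to be `τ`.
  set t₁ := min τ (T₂ u₀ v₀ x₀) with ht₁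
  have ht₁τ : t₁ ≤ τ := min_le_left _ _
  have ht₁0 : 0 ≤ t₁ := le_min hτ.1.le (hT₀.le.trans hT₀₂)
  have hsub : Icc 0 t₁ ⊆ Icc 0 τ := Icc_subset_Icc le_rfl ht₁τ
  have hctrl := Jet.controlled_of_short_time hU hV hSU hSV hq hM hM0 ht₁τ
    ((mul_le_mul_of_nonneg_left (min_le_right _ _) (sq_nonneg M)).trans hM2T)
  -- The loss is at most `(7/2) (3/2)³ / 80 = 189/1280` of `v₀(x₀)`, which is below `3/20`.
  have hvlow : ∀ t ∈ Icc 0 t₁, 17 / 20 * v₀ x₀ ≤ (jetOf τ v).f0 t (q t x₀) := by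
    intro t ht
    have h1 := (convex_Icc 0 t₁).norm_image_sub_le_of_norm_hasDerivWithin_le
      (f := fun r => (jetOf τ v).f0 r (q r x₀)) (C := 7 / 2 * (3 / 2 * M) ^ 3)
      (fun r hr => (Jet.value_along hV hU hSV hq' x₀ (hsub hr)).mono hsub)
      (fun r hr => by
        rw [norm_neg]
        exact (hctrl r hr).abs_nonloc_le hU hV _) ⟨le_rfl, ht₁0⟩ ht
    rw [Real.norm_eq_abs, Real.norm_eq_abs, sub_zero, abs_of_nonneg ht.1, hq.init] at h1
    have h2 : (jetOf τ v).f0 0 x₀ = v₀ x₀ := by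
      simp only [jetOf, clamp_of_mem h0, h.init_v]
    rw [h2] at h1
    have h3 : M ^ 3 * t ≤ v₀ x₀ / 80 := by
      rw [← hM3T]
      gcongr
      exact ht.2.trans (min_le_right _ _)
    have h4 := (abs_le.1 h1).1
    nlinarith
  have hric := riccati_comparison (w := fun t => (jetOf τ u).f1 t (q t x₀))
    (w' := fun t => Jet.slopeRate (jetOf τ u) (jetOf τ v) t (q t x₀)) (y := y)
    (c := 11 / 10 * κ) (τ := t₁) hy (by positivity)
    (fun t ht => (Jet.slope_along hU hV hSU hq x₀ (hsub ht)).mono hsub)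
    (fun t ht => by
      have hc := hctrl t ht
      refine (slopeRate_le hx₀ hM (hvlow t ht)
        ((hc.abs_f0_le hU _).trans (by linarith)) (hV.abs_le_momentum hc.2 _).2.1
        (hc.abs_nonloc₁_le hU hV _) hbdef).trans (le_of_eq ?_)
      rw [hy2, hκy]
      field_simp)
    (by
      simp only [jetOf, clamp_of_mem h0, h.init_u, hq.init]
      exact hw0)
  have hw00 : (jetOf τ u).f1 0 (q 0 x₀) = deriv u₀ x₀ := by
    simp only [jetOf, clamp_of_mem h0, h.init_u, hq.init]
  simp only [hw00, hκS] at hric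
  have hτS : 11 / 10 * τ < S := by
    by_contra! hcon
    -- At this time the upper bound of the logarithm is `0`, while the logarithm is positive.
    have hmem : 10 / 11 * S ∈ Icc 0 t₁ :=
      ⟨by positivity, le_min (by linarith) (by linarith)⟩
    obtain ⟨h1, h2⟩ := hric _ hmem
    have h3 := (le_coth_of_log_le h1 hy h2).1
    have e : κ * S - 11 / 10 * κ * (10 / 11 * S) = 0 := by ring
    linarith
  have ht₁e : t₁ = τ := min_eq_left (by linarith [hτ.1])
  refine ⟨hτS, fun t => q t x₀, hq.init x₀, fun t ht => ?_, fun t ht => ?_⟩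
  · have := hq.deriv_t x₀ t ht
    simpa only [Jet.vel, jetOf, clamp_of_mem ht] using this
  · obtain ⟨h1, h2⟩ := hric t (ht₁e ▸ ht)
    simp only [jetOf, clamp_of_mem ht] at h1 h2
    refine (le_coth_of_log_le h1 hy (h2.trans ?_)).2
    -- The surplus decay `κ t / 10` is discarded.
    nlinarith [mul_nonneg hκ.le ht.1]

/-- Trajectories of `uv` on a compact time interval are unique. -/
theorem IsStrongSolution.trajectory_unique (hs : 5 / 2 < s) {T : ℝ} {u v : ℝ → ℝ → ℝ}
    (h : IsStrongSolution s T u₀ v₀ u v) {τ : ℝ} (hτ : τ ∈ Ioo 0 T) {α β : ℝ → ℝ}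
    (hα : ∀ t ∈ Icc 0 τ, HasDerivWithinAt α (u t (α t) * v t (α t)) (Icc 0 τ) t)
    (hβ : ∀ t ∈ Icc 0 τ, HasDerivWithinAt β (u t (β t) * v t (β t)) (Icc 0 τ) t)
    (h0 : α 0 = β 0) : ∀ t ∈ Icc 0 τ, α t = β t := by
  obtain ⟨K₁, hK₁⟩ := h.regular_u.exists_isRegular hs hτ.1.le hτ.2
  obtain ⟨K₂, hK₂⟩ := h.regular_v.exists_isRegular hs hτ.1.le hτ.2
  have hb := Jet.isVelocity (hK₁.mono (le_max_left K₁ K₂)) (hK₂.mono (le_max_right K₁ K₂))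
  have conv : ∀ {γ : ℝ → ℝ},
      (∀ t ∈ Icc 0 τ, HasDerivWithinAt γ (u t (γ t) * v t (γ t)) (Icc 0 τ) t) →
      ∀ t ∈ Icc 0 τ, HasDerivWithinAt γ (Jet.vel (jetOf τ u) (jetOf τ v) t (γ t)) (Icc 0 τ) t :=
    fun hγ t ht => by simpa only [Jet.vel, jetOf, clamp_of_mem ht] using hγ t ht
  obtain ⟨hαc, hαd⟩ := clamped_trajectory hτ.1.le (conv hα)
  obtain ⟨hβc, hβd⟩ := clamped_trajectory hτ.1.le (conv hβ)
  intro t ht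
  have := hb.trajectory_sub hαc hβc hαd hβd ht
  rw [clamp_of_mem ht, clamp_of_mem ⟨le_rfl, hτ.1.le⟩, h0, sub_self, mul_zero] at this
  linarith

end BlowUp

end GengXue

/-! ### Conclusion: the maximal time and the global characteristic. -/

theorem theorem1p3 (s : ℝ) (hs : 5 / 2 < s) (u₀ v₀ : ℝ → ℝ)
    (hu₀ : GengXue.MemHs s u₀) (hu₀' : GengXue.MemW11 u₀) (hv₀ : GengXue.MemHs s v₀)
    (x₀ : ℝ) (hx₀ : 0 < v₀ x₀)
    (hslope : deriv u₀ x₀ ≤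
      (1 + Real.exp (√(GengXue.b₁ u₀ v₀ x₀ * v₀ x₀ ^ 3) / (80 * GengXue.size u₀ v₀ ^ 3))) /
        (1 - Real.exp (√(GengXue.b₁ u₀ v₀ x₀ * v₀ x₀ ^ 3) / (80 * GengXue.size u₀ v₀ ^ 3))) *
        √(GengXue.b₁ u₀ v₀ x₀ / v₀ x₀)) :
    -- the solution blows up in finite time, at a time `T* ≤ T₀`, where `T₀ ≤ T₂` is explicit
    0 < GengXue.T₀ u₀ v₀ x₀ ∧
    GengXue.T₀ u₀ v₀ x₀ ≤ GengXue.T₂ u₀ v₀ x₀ ∧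
    GengXue.maximalTime s u₀ v₀ ≤ ENNReal.ofReal (GengXue.T₀ u₀ v₀ x₀) ∧
    GengXue.maximalTime s u₀ v₀ < ENNReal.ofReal (GengXue.T₂ u₀ v₀ x₀) ∧
    -- as long as it exists, its slope along the characteristic from `x₀` lies below a function
    -- that tends to `-∞` as `t → T₀`
    ∀ (T : ℝ) (u v : ℝ → ℝ → ℝ), 0 < T → GengXue.IsStrongSolution s T u₀ v₀ u v →
      ∃ q : ℝ → ℝ, GengXue.IsCharacteristic T u v x₀ q ∧ ∀ t ∈ Set.Ico 0 T,
        deriv (u t) (q t) ≤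
          (1 + Real.exp (√(GengXue.b₁ u₀ v₀ x₀ * v₀ x₀) * (GengXue.T₀ u₀ v₀ x₀ - t))) /
            (1 - Real.exp (√(GengXue.b₁ u₀ v₀ x₀ * v₀ x₀) * (GengXue.T₀ u₀ v₀ x₀ - t))) *
            √(GengXue.b₁ u₀ v₀ x₀ / v₀ x₀) := by
  have hM : 0 < GengXue.size u₀ v₀ := hx₀.trans_le (GengXue.value_le_size hs hv₀)
  obtain ⟨-, hT₀, hT₀₂⟩ := GengXue.slope_condition hx₀ hM hslope
  -- The factor `10/11` leaves a gap below `T₀ ≤ T₂`, from which the strict inequality for `T₂`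
  -- follows.
  have hmax : GengXue.maximalTime s u₀ v₀
      ≤ ENNReal.ofReal (10 / 11 * GengXue.T₀ u₀ v₀ x₀) := by
    refine sSup_le ?_
    rintro _ ⟨T, hT, rfl, u, v, h⟩
    refine ENNReal.ofReal_le_ofReal (le_of_forall_lt fun τ hτ => ?_)
    rcases le_or_gt τ 0 with h0 | h0
    · linarith
    · have := (h.slope_bound hs hu₀' hv₀ hx₀ hslope ⟨h0, hτ⟩).1
      linarith
  refine ⟨hT₀, hT₀₂, hmax.trans (ENNReal.ofReal_le_ofReal (by linarith)),
    hmax.trans_lt ((ENNReal.ofReal_lt_ofReal_iff (by linarith)).2 (by linarith)), ?_⟩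
  intro T u v hT h
  have key := fun τ (hτ : τ ∈ Set.Ioo 0 T) => (h.slope_bound hs hu₀' hv₀ hx₀ hslope hτ).2
  choose! Q hQ0 hQd hQs using key
  obtain ⟨q, hq, hqd⟩ := GengXue.exists_glued_trajectory
    (F := fun t x => u t x * v t x) (Q := Q) hQd
    -- The trajectories chosen for different `τ` agree by uniqueness, so the bound known on each
    -- compact interval passes to the glued characteristic.
    (fun τ hτ τ' hτ' hττ' => h.trajectory_unique hs hτ (hQd τ hτ)
      (fun t ht => (hQd τ' hτ' t ⟨ht.1, ht.2.trans hττ'⟩).mono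
        (Set.Icc_subset_Icc le_rfl hττ')) (by rw [hQ0 τ hτ, hQ0 τ' hτ']))
  have hmid : ∀ t ∈ Set.Ico 0 T, (t + T) / 2 ∈ Set.Ioo 0 T ∧ t ∈ Set.Icc 0 ((t + T) / 2) :=
    fun t ht => ⟨⟨by linarith [ht.1, ht.2], by linarith [ht.2]⟩, ht.1, by linarith [ht.2]⟩
  refine ⟨q, ⟨?_, hqd⟩, fun t ht => ?_⟩
  · obtain ⟨h1, h2⟩ := hmid 0 ⟨le_rfl, hT⟩
    rw [hq _ h1 0 h2, hQ0 _ h1]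
  · obtain ⟨h1, h2⟩ := hmid t ht
    rw [hq _ h1 t h2]
    exact hQs _ h1 t h2
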